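/- Let $\Bbbk$ be an algebraically closed field and $n\ge 1$. Let $\overline{S_n}$ be the quiver with vertices $0,1,\dots,n$ and arrows $a_i\colon 0\to i$, $b_i\colon i\to 0$ for $1\le i\le n$, and let $\Lambda=\Lambda_n$ be the quotient of its path algebra (paths composed from right to left) by the relations $a_1b_1a_1=b_1a_1b_1=0$ if $n=1$, and, if $n>1$, by $b_ia_i=b_ja_j$ for all $i,j$ and $a_ib_j=0$ for all $i\ne j$. Let $e_i$ be the idempotent of $\Lambda$ at the vertex $i$, and let $\mathcal C$ be a $\Bbbk$-linear category that is $\Bbbk$-linearly equivalent to the category $\Lambda\text{-proj}$ of finitely generated projective left $\Lambda$-modules. For $0\le j\le n$ let $F_{0j}$ denote the endofunctor of $\mathcal C$ (unique up to isomorphism) which corresponds to $(\Lambda e_0\otimes_{\Bbbk} e_j\Lambda)\otimes_\Lambda -$. Let $\mathscr C^{r}_n$ be the $2$-category with one object $\mathtt i$ (identified with $\mathcal C$), whose $1$-morphisms are the endofunctors of $\mathcal C$ in the additive closure of $\mathbb 1_{\mathtt i},F_{00},F_{01},\dots,F_{0n}$ (that is, isomorphic to direct summands of finite direct sums of these functors),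 and whose $2$-morphisms are all natural transformations. A finitary $2$-representation $\mathbf M$ of $\mathscr C^{r}_n$ is a strict $2$-functor, $\Bbbk$-linear on $2$-morphisms, from $\mathscr C^{r}_n$ to the $2$-category of finitary $\Bbbk$-linear categories (those equivalent to $B\text{-proj}$ for a finite dimensional $\Bbbk$-algebra $B$), additive $\Bbbk$-linear functors and natural transformations. It is transitive if for all indecomposable objects $X,Y\in\mathbf M(\mathtt i)$ there is a $1$-morphism $F$ such that $Y$ is isomorphic to a direct summand of $\mathbf M(F)X$. It is simple if it is non-zero and has no non-zero proper ideal that is invariant under the action of all $1$-morphisms. Proposition. Every simple transitive finitary $2$-representation $\mathbf M$ of $\mathscr C^{r}_n$ has rank $1$, i.e. $\mathbf M(\mathtt i)$ has exactly one indecomposable object up to isomorphism. -/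

import Mathlib

open CategoryTheory CategoryTheory.Limits
open scoped TensorProduct ModuleCat

universe u w v w' v' u₁ v₁

/-! ### Finitary linear categories -/

/-- The category `B-proj` of finitely generated projective left `B`-modules. -/
abbrev FGProj (B : Type u) [Ring B] :=
  ObjectProperty.FullSubcategory (C := ModuleCat.{u} B)
    (fun M => Module.Finite B M ∧ Module.Projective B M)

/-- A finitary `k`-linear category: an additive `k`-linear category which is `k`-linearly
equivalent to `B-proj` for a finite dimensional associative unital `k`-algebra `B`. (Asking `B` to
be basic gives the same categories, as every finite dimensional algebra is Morita equivalent to a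
basic one.) -/
structure FinitaryCat (k : Type u) [Field k] where
  carrier : Type w
  [category : Category.{v} carrier]
  [preadditive : Preadditive carrier]
  [linear : Linear k carrier]
  [biproducts : HasFiniteBiproducts carrier]
  finitary : ∃ (B : Type u) (_ : Ring B) (_ : Algebra k B), Module.Finite k B ∧
    ∃ e : carrier ≌ FGProj B, e.functor.Additive ∧ e.functor.Linear k

namespace FinitaryCat

variable {k : Type u} [Field k]

instance : CoeSort (FinitaryCat.{u, w, v} k) (Type w) := ⟨carrier⟩

attribute [instance] category preadditive linear biproducts

instance (A : FinitaryCat.{u, w, v} k) : HasBinaryBiproducts A :=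
  hasBinaryBiproducts_of_finite_biproducts _

/-- 1-morphisms of finitary `k`-linear categories: additive `k`-linear functors. The 2-morphisms are
all natural transformations. -/
abbrev Fun (A B : FinitaryCat.{u, w, v} k) :=
  ObjectProperty.FullSubcategory (C := A ⥤ B) (fun F => F.Additive ∧ F.Linear k)

/-- The 2-category of finitary `k`-linear categories, additive `k`-linear functors and natural
transformations. -/
instance : Bicategory (FinitaryCat.{u, w, v} k) where
  Hom A B := Fun A B
  id A := ⟨𝟭 A, inferInstance, inferInstance⟩
  comp F G := ⟨F.obj ⋙ G.obj, by
    obtain ⟨F, _, _⟩ := F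
    obtain ⟨G, _, _⟩ := G
    exact ⟨inferInstance, inferInstance⟩⟩
  homCategory A B := inferInstanceAs (Category (Fun A B))
  whiskerLeft F _ _ η := ObjectProperty.homMk (Functor.whiskerLeft F.obj η.hom)
  whiskerRight η G := ObjectProperty.homMk (Functor.whiskerRight η.hom G.obj)
  associator F G H := ObjectProperty.isoMk _ (Functor.associator F.obj G.obj H.obj)
  leftUnitor F := ObjectProperty.isoMk _ F.obj.leftUnitor
  rightUnitor F := ObjectProperty.isoMk _ F.obj.rightUnitor

instance : Bicategory.Strict (FinitaryCat.{u, w, v} k) where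
  id_comp _ := rfl
  comp_id _ := rfl
  assoc _ _ _ := rfl
  leftUnitor_eqToIso _ := rfl
  rightUnitor_eqToIso _ := rfl
  associator_eqToIso _ _ _ := rfl

end FinitaryCat

/-! ### Finitary 2-representations -/

section Rep

variable (k : Type u) [Field k] (D : Type u₁) [Bicategory.{w', v'} D]
  [∀ i j : D, Preadditive (i ⟶ j)] [∀ i j : D, Linear k (i ⟶ j)]

/-- A finitary 2-representation of a `k`-linear 2-category `D`: a strict 2-functor, `k`-linear on
2-morphisms, from `D` to the 2-category of finitary `k`-linear categories. -/
structure FinitaryRep extends StrictPseudofunctor D (FinitaryCat.{u, w, v} k) where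
  map₂_add : ∀ {i j : D} {F G : i ⟶ j} (α β : F ⟶ G),
    (map₂ (α + β)).hom = (map₂ α).hom + (map₂ β).hom
  map₂_smul : ∀ {i j : D} {F G : i ⟶ j} (c : k) (α : F ⟶ G),
    (map₂ (c • α)).hom = c • (map₂ α).hom

namespace FinitaryRep

variable {k D}
variable (M : FinitaryRep.{u, w, v, w', v', u₁} k D)

/-- The functor `M(F) : M(i) ⥤ M(j)` by which the 1-morphism `F : i ⟶ j` acts. -/
abbrev act {i j : D} (F : i ⟶ j) : M.obj i ⥤ M.obj j := (M.map F).obj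

/-- `M` is transitive: for all indecomposable `X ∈ M(i)` and `Y ∈ M(j)` there is a 1-morphism
`F : i ⟶ j` such that `Y` is isomorphic to a direct summand of `M(F) X`. -/
def IsTransitive : Prop :=
  ∀ (i j : D) (X : M.obj i) (Y : M.obj j), Indecomposable X → Indecomposable Y →
    ∃ F : i ⟶ j, Nonempty (Retract Y ((M.act F).obj X))

/-- A `D`-invariant ideal of `M`: an ideal in each `M(i)`, jointly stable under all `M(F)`. -/
structure InvariantIdeal where
  carrier : ∀ (i : D) (X Y : M.obj i), Submodule k (X ⟶ Y)
  comp_left : ∀ {i : D} {X Y Z : M.obj i} (f : X ⟶ Y) (g : Y ⟶ Z),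
    g ∈ carrier i Y Z → f ≫ g ∈ carrier i X Z
  comp_right : ∀ {i : D} {X Y Z : M.obj i} (f : X ⟶ Y) (g : Y ⟶ Z),
    f ∈ carrier i X Y → f ≫ g ∈ carrier i X Z
  act_mem : ∀ {i j : D} (F : i ⟶ j) {X Y : M.obj i} (f : X ⟶ Y),
    f ∈ carrier i X Y → (M.act F).map f ∈ carrier j ((M.act F).obj X) ((M.act F).obj Y)

/-- `M` is simple: it is non-zero, and every `D`-invariant ideal of `M` is either zero or consists
of all morphisms. -/
def IsSimple : Prop :=
  (∃ (i : D) (X : M.obj i), ¬ IsZero X) ∧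
    ∀ I : M.InvariantIdeal,
      (∀ (i : D) (X Y : M.obj i), I.carrier i X Y = ⊥) ∨
      (∀ (i : D) (X Y : M.obj i), I.carrier i X Y = ⊤)

/-- The isomorphism relation on the indecomposable objects of `M(i)`. -/
def indecSetoid (i : D) : Setoid {X : M.obj i // Indecomposable X} where
  r X Y := Nonempty (X.1 ≅ Y.1)
  iseqv := ⟨fun _ => ⟨Iso.refl _⟩, fun ⟨e⟩ => ⟨e.symm⟩, fun ⟨e⟩ ⟨f⟩ => ⟨e ≪≫ f⟩⟩

/-- The number of isomorphism classes of indecomposable objects of `M(i)`. If `i` is the only object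
of `D`, this is the rank of `M`. -/
noncomputable def rank (i : D) : ℕ := Nat.card (Quotient (M.indecSetoid i))

end FinitaryRep

end Rep

/-! ### The star algebra -/

namespace StarAlg

/-- Vertices and arrows of the double quiver of the star with centre `0` and leaves `1, …, n`:
`a i` is the arrow from `0` to the leaf `i.succ`, and `b i` is the arrow back. -/
inductive Gen (n : ℕ)
  | vertex (i : Fin (n + 1))
  | a (i : Fin n)
  | b (i : Fin n)

section

variable (k : Type u) [Field k] (n : ℕ)

/-- The vertex idempotents in the free algebra. -/
def Gen.e' (i : Fin (n + 1)) : FreeAlgebra k (Gen n) := FreeAlgebra.ι k (.vertex i)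

/-- The arrows `a i` in the free algebra. -/
def Gen.a' (i : Fin n) : FreeAlgebra k (Gen n) := FreeAlgebra.ι k (.a i)

/-- The arrows `b i` in the free algebra. -/
def Gen.b' (i : Fin n) : FreeAlgebra k (Gen n) := FreeAlgebra.ι k (.b i)

open Gen in
/-- The relations of the star algebra. The first four constructors present the path algebra of the
double quiver, paths being composed from right to left; the other ones are the relations imposed on
paths, for `n = 1` and for `n > 1` respectively. -/
inductive Rel : FreeAlgebra k (Gen n) → FreeAlgebra k (Gen n) → Prop
  | e_mul_e (i j : Fin (n + 1)) : Rel (e' k n i * e' k n j) (if i = j then e' k n i else 0)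
  | sum_e : Rel (∑ i, e' k n i) 1
  | a_mem (i : Fin n) : Rel (e' k n i.succ * a' k n i * e' k n 0) (a' k n i)
  | b_mem (i : Fin n) : Rel (e' k n 0 * b' k n i * e' k n i.succ) (b' k n i)
  | aba (h : n = 1) (i : Fin n) : Rel (a' k n i * b' k n i * a' k n i) 0
  | bab (h : n = 1) (i : Fin n) : Rel (b' k n i * a' k n i * b' k n i) 0
  | ba (h : 1 < n) (i j : Fin n) : Rel (b' k n i * a' k n i) (b' k n j * a' k n j)
  | ab (h : 1 < n) (i j : Fin n) (hij : i ≠ j) : Rel (a' k n i * b' k n j) 0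

/-- The star algebra `Λ_n`. -/
def Alg : Type u := RingQuot (Rel k n)

noncomputable instance : Ring (Alg k n) := inferInstanceAs (Ring (RingQuot (Rel k n)))

noncomputable instance : Algebra k (Alg k n) := inferInstanceAs (Algebra k (RingQuot (Rel k n)))

/-- The quotient map from the free algebra to `Λ_n`. -/
noncomputable def mk : FreeAlgebra k (Gen n) →ₐ[k] Alg k n := RingQuot.mkAlgHom k (Rel k n)

theorem mk_rel {x y : FreeAlgebra k (Gen n)} (h : Rel k n x y) : mk k n x = mk k n y :=
  RingQuot.mkAlgHom_rel k h

theorem mk_surjective : Function.Surjective (mk k n) := RingQuot.mkAlgHom_surjective k (Rel k n)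

/-- The idempotent `e_i` of `Λ_n`. -/
noncomputable def e (i : Fin (n + 1)) : Alg k n := mk k n (Gen.e' k n i)

/-- The arrow `a_i` in `Λ_n`. -/
noncomputable def a (i : Fin n) : Alg k n := mk k n (Gen.a' k n i)

/-- The arrow `b_i` in `Λ_n`. -/
noncomputable def b (i : Fin n) : Alg k n := mk k n (Gen.b' k n i)

theorem e_mul_e (i j : Fin (n + 1)) : e k n i * e k n j = if i = j then e k n i else 0 := by
  have := mk_rel k n (Rel.e_mul_e (k := k) (n := n) i j)
  rw [map_mul] at this
  rw [e, e, this]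
  split_ifs <;> simp

theorem a_eq (i : Fin n) : e k n i.succ * a k n i * e k n 0 = a k n i := by
  simpa [e, a] using mk_rel k n (Rel.a_mem (k := k) (n := n) i)

theorem b_eq (i : Fin n) : e k n 0 * b k n i * e k n i.succ = b k n i := by
  simpa [e, b] using mk_rel k n (Rel.b_mem (k := k) (n := n) i)

theorem sum_e : ∑ i, e k n i = 1 := by
  simpa [e] using mk_rel k n (Rel.sum_e (k := k) (n := n))

theorem e_mul_a (j : Fin (n + 1)) (i : Fin n) :
    e k n j * a k n i = if j = i.succ then a k n i else 0 := by
  rw [← a_eq, ← mul_assoc, ← mul_assoc, e_mul_e]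
  split_ifs with h
  · rw [h]
  · simp

theorem e_mul_b (j : Fin (n + 1)) (i : Fin n) :
    e k n j * b k n i = if j = 0 then b k n i else 0 := by
  rw [← b_eq, ← mul_assoc, ← mul_assoc, e_mul_e]
  split_ifs with h
  · rw [h]
  · simp

theorem a_mul_e (j : Fin (n + 1)) (i : Fin n) :
    a k n i * e k n j = if j = 0 then a k n i else 0 := by
  rw [← a_eq, mul_assoc, e_mul_e]
  split_ifs with h h' h' <;> simp_all

theorem b_mul_e (j : Fin (n + 1)) (i : Fin n) :
    b k n i * e k n j = if j = i.succ then b k n i else 0 := by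
  rw [← b_eq, mul_assoc, e_mul_e]
  split_ifs with h h' h' <;> simp_all

theorem a_mul_a (i j : Fin n) : a k n i * a k n j = 0 := by
  rw [← a_eq k n i, mul_assoc (_ * _), e_mul_a k n 0 j, if_neg (Fin.succ_ne_zero j).symm, mul_zero]

theorem b_mul_b (i j : Fin n) : b k n i * b k n j = 0 := by
  rw [← b_eq k n i, mul_assoc (_ * _), e_mul_b k n i.succ j, if_neg (Fin.succ_ne_zero i), mul_zero]

theorem b_mul_a_of_ne (i j : Fin n) (h : i ≠ j) : b k n i * a k n j = 0 := by
  rw [← b_eq k n i, mul_assoc (_ * _), e_mul_a, if_neg (by simpa using h), mul_zero]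

theorem ba_eq (h : 1 < n) (i j : Fin n) : b k n i * a k n i = b k n j * a k n j := by
  simpa [a, b] using mk_rel k n (Rel.ba (k := k) h i j)

theorem a_mul_b_of_ne (i j : Fin n) (h : i ≠ j) : a k n i * b k n j = 0 := by
  have hn : 1 < n := by
    have := i.2; have := j.2
    have : (i : ℕ) ≠ j := fun h' => h (Fin.ext h')
    omega
  simpa [a, b] using mk_rel k n (Rel.ab (k := k) hn i j h)

theorem aba_eq_zero (i : Fin n) : a k n i * b k n i * a k n i = 0 := by
  by_cases hn : n = 1
  · simpa [a, b] using mk_rel k n (Rel.aba (k := k) hn i)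
  · have hn : 1 < n := by have := i.2; omega
    have : Nontrivial (Fin n) := Fin.nontrivial_iff_two_le.2 hn
    obtain ⟨j, hj⟩ := exists_ne i
    rw [mul_assoc, ba_eq k n hn i j, ← mul_assoc, a_mul_b_of_ne k n i j hj.symm, zero_mul]

theorem bab_eq_zero (i : Fin n) : b k n i * a k n i * b k n i = 0 := by
  by_cases hn : n = 1
  · simpa [a, b] using mk_rel k n (Rel.bab (k := k) hn i)
  · have hn : 1 < n := by have := i.2; omega
    have : Nontrivial (Fin n) := Fin.nontrivial_iff_two_le.2 hn
    obtain ⟨j, hj⟩ := exists_ne i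
    rw [ba_eq k n hn i j, mul_assoc, a_mul_b_of_ne k n j i hj, mul_zero]

/-- `Λ_n` is spanned by the paths of length at most two which return to their start or have length at
most one. -/
noncomputable def spanning : Fin (n + 1) ⊕ Fin n ⊕ Fin n ⊕ Fin n ⊕ Fin n → Alg k n
  | .inl i => e k n i
  | .inr (.inl i) => a k n i
  | .inr (.inr (.inl i)) => b k n i
  | .inr (.inr (.inr (.inl i))) => a k n i * b k n i
  | .inr (.inr (.inr (.inr i))) => b k n i * a k n i

theorem gen_mul_mem (g : Gen n) (x : Alg k n) (hx : x ∈ Submodule.span k (Set.range (spanning k n))) :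
    mk k n (FreeAlgebra.ι k g) * x ∈
      Submodule.span k (Set.range (spanning k n)) := by
  have he : ∀ i, e k n i ∈ Submodule.span k (Set.range (spanning k n)) :=
    fun i => Submodule.subset_span ⟨.inl i, rfl⟩
  have ha : ∀ i, a k n i ∈ Submodule.span k (Set.range (spanning k n)) :=
    fun i => Submodule.subset_span ⟨.inr (.inl i), rfl⟩
  have hb : ∀ i, b k n i ∈ Submodule.span k (Set.range (spanning k n)) :=
    fun i => Submodule.subset_span ⟨.inr (.inr (.inl i)), rfl⟩
  have hab : ∀ i, a k n i * b k n i ∈ Submodule.span k (Set.range (spanning k n)) :=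
    fun i => Submodule.subset_span ⟨.inr (.inr (.inr (.inl i))), rfl⟩
  have hba : ∀ i, b k n i * a k n i ∈ Submodule.span k (Set.range (spanning k n)) :=
    fun i => Submodule.subset_span ⟨.inr (.inr (.inr (.inr i))), rfl⟩
  have h0 := Submodule.zero_mem (Submodule.span k (Set.range (spanning k n)))
  induction hx using Submodule.span_induction with
  | zero => simp
  | add x y _ _ hx hy => rw [mul_add]; exact Submodule.add_mem _ hx hy
  | smul c x _ hx => rw [mul_smul_comm]; exact Submodule.smul_mem _ c hx
  | mem x hx =>
    obtain ⟨s, rfl⟩ := hx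
    cases g with
    | vertex j =>
      change e k n j * _ ∈ _
      rcases s with i | i | i | i | i <;> simp only [spanning, ← mul_assoc]
      · rw [e_mul_e]; split_ifs; exacts [he _, h0]
      · rw [e_mul_a]; split_ifs; exacts [ha _, h0]
      · rw [e_mul_b]; split_ifs; exacts [hb _, h0]
      · rw [e_mul_a]; split_ifs; exacts [hab _, by simp]
      · rw [e_mul_b]; split_ifs; exacts [hba _, by simp]
    | a j =>
      change a k n j * _ ∈ _
      rcases s with i | i | i | i | i <;> simp only [spanning, ← mul_assoc]
      · rw [a_mul_e]; split_ifs; exacts [ha _, h0]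
      · rw [a_mul_a]; exact h0
      · by_cases h : j = i
        · rw [h]; exact hab _
        · rw [a_mul_b_of_ne k n _ _ h]; exact h0
      · rw [a_mul_a, zero_mul]; exact h0
      · by_cases h : j = i
        · rw [h, aba_eq_zero]; exact h0
        · rw [a_mul_b_of_ne k n _ _ h, zero_mul]; exact h0
    | b j =>
      change b k n j * _ ∈ _
      rcases s with i | i | i | i | i <;> simp only [spanning, ← mul_assoc]
      · rw [b_mul_e]; split_ifs; exacts [hb _, h0]
      · by_cases h : j = i
        · rw [h]; exact hba _
        · rw [b_mul_a_of_ne k n _ _ h]; exact h0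
      · rw [b_mul_b]; exact h0
      · by_cases h : j = i
        · rw [h, bab_eq_zero]; exact h0
        · rw [b_mul_a_of_ne k n _ _ h, zero_mul]; exact h0
      · rw [b_mul_b, zero_mul]; exact h0

theorem span_spanning : Submodule.span k (Set.range (spanning k n)) = ⊤ := by
  have key : ∀ z : FreeAlgebra k (Gen n), ∀ x ∈ Submodule.span k (Set.range (spanning k n)),
      mk k n z * x ∈ Submodule.span k (Set.range (spanning k n)) := by
    intro z
    induction z using FreeAlgebra.induction with
    | grade0 r =>
      intro x hx
      rw [AlgHom.commutes, ← Algebra.smul_def]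
      exact Submodule.smul_mem _ r hx
    | grade1 g => exact gen_mul_mem k n g
    | mul y z hy hz => intro x hx; rw [map_mul, mul_assoc]; exact hy _ (hz _ hx)
    | add y z hy hz =>
      intro x hx; rw [map_add, add_mul]; exact Submodule.add_mem _ (hy _ hx) (hz _ hx)
  rw [eq_top_iff]
  rintro y -
  obtain ⟨z, rfl⟩ := mk_surjective k n y
  rw [← mul_one (mk k n z)]
  refine key z 1 ?_
  rw [← sum_e]
  exact Submodule.sum_mem _ fun i _ => Submodule.subset_span ⟨.inl i, rfl⟩

instance : Module.Finite k (Alg k n) :=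
  ⟨span_spanning k n ▸ Submodule.fg_span (Set.finite_range _)⟩

end

end StarAlg

/-! ### Tensor products over a noncommutative algebra -/

section Balanced

variable (k : Type u) [Field k] (L : Type u) [Ring L] [Algebra k L]
  (R : Type u) [AddCommGroup R] [Module k R] [Module Lᵐᵒᵖ R]

/-- The relations `(r · x) ⊗ m = r ⊗ (x · m)`. -/
def balancedRel (N : Type u) [AddCommGroup N] [Module k N] [Module L N] :
    Submodule k (R ⊗[k] N) :=
  Submodule.span k {t | ∃ (r : R) (x : L) (m : N),
    t = (MulOpposite.op x • r) ⊗ₜ[k] m - r ⊗ₜ[k] (x • m)}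

/-- The tensor product `R ⊗_L N` of a right `L`-module `R` and a left `L`-module `N` over a
(noncommutative) `k`-algebra `L`. -/
abbrev BalancedTensor (N : Type u) [AddCommGroup N] [Module k N] [Module L N] : Type u :=
  (R ⊗[k] N) ⧸ balancedRel k L R N

variable {N N' : Type u} [AddCommGroup N] [Module k N] [Module L N] [IsScalarTower k L N]
  [AddCommGroup N'] [Module k N'] [Module L N'] [IsScalarTower k L N']

/-- The map `R ⊗_L f`. -/
def BalancedTensor.map (f : N →ₗ[L] N') : BalancedTensor k L R N →ₗ[k] BalancedTensor k L R N' :=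
  Submodule.mapQ _ _ ((f.restrictScalars k).lTensor R) (by
    refine Submodule.span_le.2 ?_
    rintro _ ⟨r, x, m, rfl⟩
    refine Submodule.subset_span ⟨r, x, f m, ?_⟩
    simp)

end Balanced

/-! ### Projective functors over the star algebra -/

namespace StarAlg

section

variable (k : Type u) [Field k] (n : ℕ)

/-- The left ideal `Λ e_i`. -/
abbrev LeftProj (i : Fin (n + 1)) : Type u := Submodule.span (Alg k n) {e k n i}

/-- The right ideal `e_i Λ`, a right module over `Λ`. -/
abbrev RightProj (i : Fin (n + 1)) : Type u := Submodule.span (Alg k n)ᵐᵒᵖ {e k n i}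

/-- The functor `Λ e_i ⊗_k (e_j Λ ⊗_Λ -)` of tensoring with the bimodule `Λ e_i ⊗_k e_j Λ`. -/
noncomputable def projFunctor (i j : Fin (n + 1)) :
    ModuleCat.{u} (Alg k n) ⥤ ModuleCat.{u} (Alg k n) where
  obj N := ModuleCat.of (Alg k n)
    (LeftProj k n i ⊗[k] BalancedTensor k (Alg k n) (RightProj k n j) N)
  map f := ModuleCat.ofHom (TensorProduct.AlgebraTensorModule.lTensor (Alg k n) (LeftProj k n i)
    (BalancedTensor.map k (Alg k n) (RightProj k n j) f.hom))
  map_id N := by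
    ext : 1
    refine TensorProduct.AlgebraTensorModule.curry_injective ?_
    ext x y
    rfl
  map_comp f g := by
    ext : 1
    refine TensorProduct.AlgebraTensorModule.curry_injective ?_
    ext x y
    rfl

instance (i j : Fin (n + 1)) : (projFunctor k n i j).Additive where
  map_add {N N' f g} := by
    ext : 1
    refine TensorProduct.AlgebraTensorModule.curry_injective ?_
    ext x y z
    change x ⊗ₜ[k] (Submodule.Quotient.mk (y ⊗ₜ[k] (f.hom z + g.hom z))) =
      x ⊗ₜ[k] (Submodule.Quotient.mk (y ⊗ₜ[k] f.hom z)) +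
        x ⊗ₜ[k] (Submodule.Quotient.mk (y ⊗ₜ[k] g.hom z))
    rw [TensorProduct.tmul_add, Submodule.Quotient.mk_add, TensorProduct.tmul_add]

section Contract

variable {k n}

/-- The two (equal) `k`-module structures on the left module `Λ e_i ⊗ V`. -/
noncomputable def changeScalars (i : Fin (n + 1)) (V : Type u) [AddCommGroup V] [Module k V] :
    ModuleCat.of (Alg k n) (LeftProj k n i ⊗[k] V) ≃ₗ[k] LeftProj k n i ⊗[k] V where
  toFun x := x
  invFun x := x
  map_add' _ _ := rfl
  map_smul' c x := algebraMap_smul (Alg k n) c (show LeftProj k n i ⊗[k] V from x)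
  left_inv _ := rfl
  right_inv _ := rfl

/-- The bilinear map `(y, z) ↦ φ (y z)`. -/
noncomputable def pairing (i m : Fin (n + 1)) (φ : Alg k n →ₗ[k] k) :
    RightProj k n i →ₗ[k] LeftProj k n m →ₗ[k] k :=
  ((LinearMap.mul k (Alg k n)).compr₂ φ).compl₁₂
    ((Submodule.span (Alg k n)ᵐᵒᵖ {e k n i}).subtype.restrictScalars k)
    ((Submodule.span (Alg k n) {e k n m}).subtype.restrictScalars k)

/-- The map `y ⊗ (z ⊗ v) ↦ φ (y z) v` on the tensor product over `k`. -/
noncomputable def contract' (i m : Fin (n + 1)) (φ : Alg k n →ₗ[k] k)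
    (V : Type u) [AddCommGroup V] [Module k V] :
    RightProj k n i ⊗[k] ModuleCat.of (Alg k n) (LeftProj k n m ⊗[k] V) →ₗ[k] V :=
  (TensorProduct.lid k V).toLinearMap ∘ₗ (TensorProduct.lift (pairing i m φ)).rTensor V ∘ₗ
    (TensorProduct.assoc k _ _ V).symm.toLinearMap ∘ₗ
    (changeScalars m V).toLinearMap.lTensor (RightProj k n i)

theorem contract'_tmul (i m : Fin (n + 1)) (φ : Alg k n →ₗ[k] k)
    (V : Type u) [AddCommGroup V] [Module k V] (y : RightProj k n i) (z : LeftProj k n m) (v : V) :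
    contract' i m φ V (y ⊗ₜ[k] (show ModuleCat.of (Alg k n) (LeftProj k n m ⊗[k] V) from
      z ⊗ₜ[k] v)) = φ ((y : Alg k n) * z) • v := rfl

theorem contract'_smul (i m : Fin (n + 1)) (φ : Alg k n →ₗ[k] k)
    (V : Type u) [AddCommGroup V] [Module k V] (y : RightProj k n i) (x : Alg k n)
    (w : ModuleCat.of (Alg k n) (LeftProj k n m ⊗[k] V)) :
    contract' i m φ V ((MulOpposite.op x • y) ⊗ₜ[k] w) = contract' i m φ V (y ⊗ₜ[k] (x • w)) := by
  induction w using TensorProduct.induction_on with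
  | zero =>
    change contract' i m φ V ((MulOpposite.op x • y) ⊗ₜ[k] 0) = contract' i m φ V (y ⊗ₜ[k] (x • 0))
    rw [smul_zero, TensorProduct.tmul_zero, TensorProduct.tmul_zero]
  | add w w' hw hw' =>
    have := congrArg₂ (· + ·) hw hw'
    simp only [← map_add, ← TensorProduct.tmul_add, ← smul_add] at this
    exact this
  | tmul z v =>
    change _ = contract' i m φ V (y ⊗ₜ[k] (show ModuleCat.of (Alg k n) (LeftProj k n m ⊗[k] V) from
      (x • z) ⊗ₜ[k] v))
    rw [contract'_tmul]
    refine (contract'_tmul i m φ V (MulOpposite.op x • y) z v).trans ?_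
    exact congrArg (fun t => φ t • v) (mul_assoc (y : Alg k n) x z)

/-- The map `y ⊗ (z ⊗ v) ↦ φ (y z) v`. -/
noncomputable def contract (i m : Fin (n + 1)) (φ : Alg k n →ₗ[k] k)
    (V : Type u) [AddCommGroup V] [Module k V] :
    BalancedTensor k (Alg k n) (RightProj k n i)
      (ModuleCat.of (Alg k n) (LeftProj k n m ⊗[k] V)) →ₗ[k] V :=
  Submodule.liftQ _ (contract' i m φ V) (by
    refine Submodule.span_le.2 ?_
    rintro _ ⟨r, x, w, rfl⟩
    exact (map_sub _ _ _).trans (sub_eq_zero.2 (contract'_smul i m φ V r x w)))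

theorem contract_naturality (i m : Fin (n + 1)) (φ : Alg k n →ₗ[k] k)
    {V V' : Type u} [AddCommGroup V] [Module k V] [AddCommGroup V'] [Module k V'] (g : V →ₗ[k] V')
    (t : BalancedTensor k (Alg k n) (RightProj k n i)
      (ModuleCat.of (Alg k n) (LeftProj k n m ⊗[k] V))) :
    contract i m φ V' (BalancedTensor.map k (Alg k n) (RightProj k n i)
      (N := ModuleCat.of (Alg k n) (LeftProj k n m ⊗[k] V))
      (N' := ModuleCat.of (Alg k n) (LeftProj k n m ⊗[k] V'))
      (TensorProduct.AlgebraTensorModule.lTensor (Alg k n) (LeftProj k n m) g) t) =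
      g (contract i m φ V t) := by
  rw [← LinearMap.comp_apply, ← LinearMap.comp_apply]
  refine LinearMap.congr_fun (Submodule.linearMap_qext _ (TensorProduct.ext' fun y w => ?_)) t
  induction w using TensorProduct.induction_on with
  | zero => exact (congrArg _ (TensorProduct.tmul_zero _ _)).trans ((map_zero _).trans
      ((map_zero _).symm.trans (congrArg _ (TensorProduct.tmul_zero _ _).symm)))
  | add w w' hw hw' =>
    have := congrArg₂ (· + ·) hw hw'
    simp only [← map_add, ← TensorProduct.tmul_add] at this
    exact this
  | tmul z v => exact (map_smul g (φ ((y : Alg k n) * z)) v).symm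

/-- The map `v ↦ e_i ⊗ (c e_m ⊗ v)`. -/
noncomputable def unitMap (i m : Fin (n + 1)) (c : Alg k n)
    (V : Type u) [AddCommGroup V] [Module k V] :
    V →ₗ[k] BalancedTensor k (Alg k n) (RightProj k n i)
      (ModuleCat.of (Alg k n) (LeftProj k n m ⊗[k] V)) :=
  Submodule.mkQ _ ∘ₗ TensorProduct.mk k _ _ ⟨e k n i, Submodule.subset_span rfl⟩ ∘ₗ
    (changeScalars m V).symm.toLinearMap ∘ₗ
    TensorProduct.mk k _ _ ⟨c * e k n m, Submodule.smul_mem _ c (Submodule.subset_span rfl)⟩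

theorem sum_contract_unitMap (i m : Fin (n + 1)) (V : Type u) [AddCommGroup V] [Module k V] :
    ∑ t, unitMap i m (Module.finBasis k (Alg k n) t) V ∘ₗ
      contract i m ((Module.finBasis k (Alg k n)).coord t) V = LinearMap.id := by
  refine Submodule.linearMap_qext _ (TensorProduct.ext' fun y w => ?_)
  simp only [LinearMap.comp_apply, LinearMap.sum_apply, LinearMap.id_apply]
  induction w using TensorProduct.induction_on with
  | zero =>
    change ∑ t, unitMap i m _ V (contract i m _ V (Submodule.mkQ _ (y ⊗ₜ[k] 0))) =
      Submodule.mkQ _ (y ⊗ₜ[k] 0)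
    simp only [TensorProduct.tmul_zero, map_zero, Finset.sum_const_zero]
  | add w w' hw hw' =>
    have := congrArg₂ (· + ·) hw hw'
    simp only [← Finset.sum_add_distrib, ← map_add, ← TensorProduct.tmul_add] at this
    exact this
  | tmul z v =>
    have hy : e k n i * (y : Alg k n) = y := by
      obtain ⟨y, hy⟩ := y
      obtain ⟨x, rfl⟩ := Submodule.mem_span_singleton.1 hy
      change e k n i * (e k n i * x.unop) = e k n i * x.unop
      rw [← mul_assoc, e_mul_e, if_pos rfl]
    have hz : (z : Alg k n) * e k n m = z := by
      obtain ⟨z, hz⟩ := z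
      obtain ⟨x, rfl⟩ := Submodule.mem_span_singleton.1 hz
      change x * e k n m * e k n m = x * e k n m
      rw [mul_assoc, e_mul_e, if_pos rfl]
    let B := Module.finBasis k (Alg k n)
    let W := ModuleCat.of (Alg k n) (LeftProj k n m ⊗[k] V)
    let E : RightProj k n i := ⟨e k n i, Submodule.subset_span rfl⟩
    let T : LeftProj k n m →ₗ[k] BalancedTensor k (Alg k n) (RightProj k n i) W :=
      Submodule.mkQ _ ∘ₗ TensorProduct.mk k _ W E ∘ₗ (changeScalars m V).symm.toLinearMap ∘ₗ
        (TensorProduct.mk k _ V).flip v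
    let C : Alg k n →ₗ[k] LeftProj k n m :=
      { toFun := fun c => ⟨c * e k n m, Submodule.smul_mem _ c (Submodule.subset_span rfl)⟩
        map_add' := fun c d => Subtype.ext (add_mul c d _)
        map_smul' := fun r c => Subtype.ext (smul_mul_assoc r c _) }
    have h1 : ∀ t, unitMap i m (B t) V (contract i m (B.coord t) V (Submodule.mkQ _ (y ⊗ₜ[k]
        (show W from z ⊗ₜ[k] v)))) = T (C (B.coord t ((y : Alg k n) * z) • B t)) := by
      intro t
      rw [map_smul, map_smul]
      exact map_smul (unitMap i m (B t) V) (B.coord t ((y : Alg k n) * z)) v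
    refine (Finset.sum_congr rfl fun t _ => h1 t).trans ?_
    rw [← map_sum, ← map_sum]
    have h2 : ∑ t, B.coord t ((y : Alg k n) * z) • B t = (y : Alg k n) * z :=
      B.sum_repr _
    rw [h2]
    have h3 : C ((y : Alg k n) * z) = (y : Alg k n) • z :=
      Subtype.ext (by change (y : Alg k n) * z * e k n m = y * z; rw [mul_assoc, hz])
    rw [h3]
    have h4 : MulOpposite.op (y : Alg k n) • E = y := Subtype.ext hy
    refine Eq.symm ((Submodule.Quotient.eq _).2 (Submodule.subset_span ⟨E, y,
      (show W from z ⊗ₜ[k] v), ?_⟩))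
    rw [h4]
    rfl

/-- The natural transformation given by `contract`. -/
noncomputable def contractNat (i m j l : Fin (n + 1)) (φ : Alg k n →ₗ[k] k) :
    projFunctor k n m j ⋙ projFunctor k n l i ⟶ projFunctor k n l j where
  app N := ModuleCat.ofHom (TensorProduct.AlgebraTensorModule.lTensor (Alg k n) (LeftProj k n l)
    (contract i m φ (BalancedTensor k (Alg k n) (RightProj k n j) N)))
  naturality N N' f := by
    ext : 1
    refine TensorProduct.AlgebraTensorModule.curry_injective ?_
    ext x y z
    exact congrArg (fun t => x ⊗ₜ[k] t) (contract_naturality i m φ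
      (BalancedTensor.map k (Alg k n) (RightProj k n j) f.hom) (Submodule.mkQ _ (y ⊗ₜ[k] z)))

/-- The natural transformation given by `unitMap`. -/
noncomputable def unitNat (i m j l : Fin (n + 1)) (c : Alg k n) :
    projFunctor k n l j ⟶ projFunctor k n m j ⋙ projFunctor k n l i where
  app N := ModuleCat.ofHom (TensorProduct.AlgebraTensorModule.lTensor (Alg k n) (LeftProj k n l)
    (unitMap i m c (BalancedTensor k (Alg k n) (RightProj k n j) N)))
  naturality N N' f := by
    ext : 1
    refine TensorProduct.AlgebraTensorModule.curry_injective ?_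
    ext x y z
    rfl

theorem sum_lTensor (i m l : Fin (n + 1)) (V : Type u) [AddCommGroup V] [Module k V] :
    ∑ t, TensorProduct.AlgebraTensorModule.lTensor (Alg k n) (LeftProj k n l)
        (unitMap i m (Module.finBasis k (Alg k n) t) V) ∘ₗ
      TensorProduct.AlgebraTensorModule.lTensor (Alg k n) (LeftProj k n l)
        (contract i m ((Module.finBasis k (Alg k n)).coord t) V) = LinearMap.id := by
  refine LinearMap.ext fun z => ?_
  rw [LinearMap.sum_apply]
  induction z using TensorProduct.induction_on with
  | zero => simp only [map_zero, Finset.sum_const_zero]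
  | add z z' hz hz' => simp only [map_add, Finset.sum_add_distrib, hz, hz']
  | tmul x t =>
    have h := LinearMap.congr_fun (sum_contract_unitMap (k := k) (n := n) i m V) t
    rw [LinearMap.sum_apply] at h
    change ∑ s, x ⊗ₜ[k] _ = _
    rw [← TensorProduct.tmul_sum]
    exact congrArg (fun t => x ⊗ₜ[k] t) h

theorem sum_contractNat_unitNat (i m j l : Fin (n + 1)) :
    ∑ t, contractNat i m j l ((Module.finBasis k (Alg k n)).coord t) ≫
      unitNat i m j l (Module.finBasis k (Alg k n) t) = 𝟙 _ := by
  ext N : 2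
  rw [NatTrans.app_sum]
  ext : 1
  rw [ModuleCat.hom_sum]
  exact sum_lTensor i m l (BalancedTensor k (Alg k n) (RightProj k n j) N)

end Contract

end

end StarAlg

/-! ### The right cell 2-category -/

/-- The additive closure of a class `S` of objects: `X` belongs to it if its identity factors through
a finite direct sum of objects in `S`, that is, if `X` is a direct summand of such a sum. -/
def addClosure {D : Type u₁} [Category.{v₁} D] [Preadditive D] (S : ObjectProperty D) :
    ObjectProperty D := fun X =>
  ∃ (ι : Type) (_ : Fintype ι) (Y : ι → D), (∀ t, S (Y t)) ∧
    ∃ (s : ∀ t, X ⟶ Y t) (r : ∀ t, Y t ⟶ X), ∑ t, s t ≫ r t = 𝟙 X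

theorem addClosure_of_mem {D : Type u₁} [Category.{v₁} D] [Preadditive D] {S : ObjectProperty D}
    {X : D} (h : S X) : addClosure S X :=
  ⟨Unit, inferInstance, fun _ => X, fun _ => h, fun _ => 𝟙 X, fun _ => 𝟙 X, by simp⟩

theorem addClosure_of_sum {D : Type u₁} [Category.{v₁} D] [Preadditive D] {S : ObjectProperty D}
    {X : D} {ι : Type} [Fintype ι] (Y : ι → D) (hY : ∀ t, addClosure S (Y t))
    (s : ∀ t, X ⟶ Y t) (r : ∀ t, Y t ⟶ X) (h : ∑ t, s t ≫ r t = 𝟙 X) : addClosure S X := by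
  choose κ _ Z hZ s' r' h' using hY
  refine ⟨Σ t, κ t, inferInstance, fun p => Z p.1 p.2, fun p => hZ _ _,
    fun p => s p.1 ≫ s' p.1 p.2, fun p => r' p.1 p.2 ≫ r p.1, ?_⟩
  rw [Fintype.sum_sigma, ← h]
  refine Finset.sum_congr rfl fun t _ => ?_
  have : ∀ a, (s t ≫ s' t a) ≫ r' t a ≫ r t = s t ≫ (s' t a ≫ r' t a) ≫ r t := by simp
  simp only [this]
  rw [← Preadditive.comp_sum, ← Preadditive.sum_comp, h', Category.id_comp]

section RightCell

variable {k : Type u} [Field k] {n : ℕ} {C : Type w} [Category.{v} C] [Preadditive C]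

/-- The inclusion of `C`, a category equivalent to `Λ-proj`, into the category of all left
`Λ`-modules. -/
noncomputable abbrev toMod (E : C ≌ FGProj (StarAlg.Alg k n)) : C ⥤ ModuleCat.{u} (StarAlg.Alg k n) :=
  E.functor ⋙ ObjectProperty.ι _

/-- The endofunctor `G` of `C ≌ Λ-proj` is isomorphic to `F_ij`, that is, to tensoring with the
bimodule `Λ e_i ⊗_k e_j Λ`. -/
def IsProjFunctor (E : C ≌ FGProj (StarAlg.Alg k n)) (i j : Fin (n + 1)) (G : C ⥤ C) : Prop :=
  Nonempty (G ⋙ toMod E ≅ toMod E ⋙ StarAlg.projFunctor k n i j)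

/-- The endofunctors of `C ≌ Λ-proj` isomorphic to the identity or to one of `F_00, F_01, …, F_0n`. -/
def rightCellGenerators (E : C ≌ FGProj (StarAlg.Alg k n)) : ObjectProperty (C ⥤ C) := fun G =>
  Nonempty (G ≅ 𝟭 C) ∨ ∃ j, IsProjFunctor E 0 j G

/-- The 1-morphisms of the right cell 2-category: the additive closure of `1, F_00, F_01, …, F_0n`
in the category of endofunctors of `C ≌ Λ-proj`. -/
abbrev rightCellMor (E : C ≌ FGProj (StarAlg.Alg k n)) : ObjectProperty (C ⥤ C) :=
  addClosure (rightCellGenerators E)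

theorem rightCellMor_id (E : C ≌ FGProj (StarAlg.Alg k n)) : rightCellMor E (𝟭 C) :=
  addClosure_of_mem (Or.inl ⟨Iso.refl _⟩)

theorem rightCellGenerators_additive (E : C ≌ FGProj (StarAlg.Alg k n)) [E.functor.Additive]
    {G : C ⥤ C} (hG : rightCellGenerators E G) : G.Additive := by
  obtain ⟨⟨e⟩⟩ | ⟨j, ⟨e⟩⟩ := hG
  · exact Functor.additive_of_iso e.symm
  · have : (toMod E ⋙ StarAlg.projFunctor k n 0 j).Additive := inferInstance
    have : (G ⋙ toMod E).Additive := Functor.additive_of_iso e.symm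
    exact ⟨fun {X Y f g} => (toMod E).map_injective (by
      rw [(toMod E).map_add]
      exact (G ⋙ toMod E).map_add)⟩

theorem rightCellMor_comp_generators (E : C ≌ FGProj (StarAlg.Alg k n)) [E.functor.Additive]
    {G H : C ⥤ C} (hG : rightCellGenerators E G) (hH : rightCellGenerators E H) :
    rightCellMor E (G ⋙ H) := by
  have hG' := hG
  obtain ⟨⟨e⟩⟩ | ⟨i, ⟨e⟩⟩ := hG
  · refine addClosure_of_mem ?_
    let e' : G ⋙ H ≅ H := Functor.isoWhiskerRight e H ≪≫ H.leftUnitor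
    obtain ⟨⟨f⟩⟩ | ⟨j, ⟨f⟩⟩ := hH
    · exact Or.inl ⟨e' ≪≫ f⟩
    · exact Or.inr ⟨j, ⟨Functor.isoWhiskerRight e' _ ≪≫ f⟩⟩
  obtain ⟨⟨f⟩⟩ | ⟨j, ⟨f⟩⟩ := hH
  · let f' : G ⋙ H ≅ G := Functor.isoWhiskerLeft G f ≪≫ G.rightUnitor
    exact addClosure_of_mem (Or.inr ⟨i, ⟨Functor.isoWhiskerRight f' _ ≪≫ e⟩⟩)
  let K := toMod E
  let P := StarAlg.projFunctor k n
  let g : (G ⋙ H) ⋙ K ≅ K ⋙ P 0 i ⋙ P 0 j :=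
    Functor.associator _ _ _ ≪≫ Functor.isoWhiskerLeft G f ≪≫ (Functor.associator _ _ _).symm ≪≫
      Functor.isoWhiskerRight e (P 0 j) ≪≫ Functor.associator _ _ _
  let W := (Functor.whiskeringRight C C (ModuleCat.{u} (StarAlg.Alg k n))).obj K
  let hW : W.FullyFaithful := (Functor.FullyFaithful.ofFullyFaithful K).whiskeringRight C
  have : W.Faithful := hW.faithful
  have : W.Additive := ⟨fun {X Y f g} => by
    ext x : 2
    exact K.map_add⟩
  let b := Module.finBasis k (StarAlg.Alg k n)
  let s : ∀ t, W.obj (G ⋙ H) ⟶ W.obj G := fun t =>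
    g.hom ≫ Functor.whiskerLeft K (StarAlg.contractNat j 0 i 0 (b.coord t)) ≫ e.inv
  let r : ∀ t, W.obj G ⟶ W.obj (G ⋙ H) := fun t =>
    e.hom ≫ Functor.whiskerLeft K (StarAlg.unitNat j 0 i 0 (b t)) ≫ g.inv
  have hsr : ∑ t, s t ≫ r t = 𝟙 _ := by
    have h1 : ∀ t, s t ≫ r t = g.hom ≫ Functor.whiskerLeft K
        (StarAlg.contractNat j 0 i 0 (b.coord t) ≫ StarAlg.unitNat j 0 i 0 (b t)) ≫ g.inv := by
      intro t
      simp [s, r]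
    have h2 : ∑ t, Functor.whiskerLeft K
        (StarAlg.contractNat j 0 i 0 (b.coord t) ≫ StarAlg.unitNat j 0 i 0 (b t)) = 𝟙 _ := by
      ext X : 2
      rw [NatTrans.app_sum]
      have := congrArg (fun α => α.app (K.obj X))
        (StarAlg.sum_contractNat_unitNat (k := k) (n := n) j 0 i 0)
      rw [NatTrans.app_sum] at this
      exact this
    simp only [h1]
    rw [← Preadditive.comp_sum, ← Preadditive.sum_comp, h2, Category.id_comp, g.hom_inv_id]
    rfl
  refine ⟨Fin _, inferInstance, fun _ => G, fun _ => hG', fun t => hW.preimage (s t),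
    fun t => hW.preimage (r t), W.map_injective ?_⟩
  rw [W.map_sum, W.map_id, ← hsr]
  exact Finset.sum_congr rfl fun t _ => by rw [W.map_comp, hW.map_preimage, hW.map_preimage]

theorem rightCellMor_comp (E : C ≌ FGProj (StarAlg.Alg k n)) [E.functor.Additive]
    {G H : C ⥤ C} (hG : rightCellMor E G) (hH : rightCellMor E H) :
    rightCellMor E (G ⋙ H) := by
  obtain ⟨κ, _, H', hH', s', r', h'⟩ := hH
  refine addClosure_of_sum (fun t => G ⋙ H' t) (fun t => ?_)
    (fun t => Functor.whiskerLeft G (s' t)) (fun t => Functor.whiskerLeft G (r' t)) ?_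
  · obtain ⟨ι, _, G', hG', s, r, h⟩ := hG
    have := rightCellGenerators_additive E (hH' t)
    refine addClosure_of_sum (fun p => G' p ⋙ H' t)
      (fun p => rightCellMor_comp_generators E (hG' p) (hH' t))
      (fun p => Functor.whiskerRight (s p) (H' t)) (fun p => Functor.whiskerRight (r p) (H' t)) ?_
    ext X
    have := congrArg (fun α => (H' t).map (α.app X)) h
    simpa [NatTrans.app_sum, Functor.map_sum] using this
  · ext X
    have := congrArg (fun α => α.app (G.obj X)) h'
    simpa [NatTrans.app_sum] using this

/-- The right cell 2-category has a single object. -/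
inductive RightCell (E : C ≌ FGProj (StarAlg.Alg k n)) : Type
  | star

namespace RightCell

variable (E : C ≌ FGProj (StarAlg.Alg k n)) [E.functor.Additive]

/-- The right cell 2-category: its single object is `C ≌ Λ-proj`, its 1-morphisms are the endofunctors
of `C` in the additive closure of `1, F_00, F_01, …, F_0n`, and its 2-morphisms are all natural
transformations. -/
instance : Bicategory (RightCell E) where
  Hom _ _ := (rightCellMor E).FullSubcategory
  id _ := ⟨𝟭 C, rightCellMor_id E⟩
  comp F G := ⟨F.obj ⋙ G.obj, rightCellMor_comp E F.property G.property⟩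
  homCategory _ _ := inferInstanceAs (Category (rightCellMor E).FullSubcategory)
  whiskerLeft F _ _ η := ObjectProperty.homMk (Functor.whiskerLeft F.obj η.hom)
  whiskerRight η G := ObjectProperty.homMk (Functor.whiskerRight η.hom G.obj)
  associator F G H := ObjectProperty.isoMk _ (Functor.associator F.obj G.obj H.obj)
  leftUnitor F := ObjectProperty.isoMk _ F.obj.leftUnitor
  rightUnitor F := ObjectProperty.isoMk _ F.obj.rightUnitor

instance : Bicategory.Strict (RightCell E) where
  id_comp _ := rfl
  comp_id _ := rfl
  assoc _ _ _ := rfl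
  leftUnitor_eqToIso _ := rfl
  rightUnitor_eqToIso _ := rfl
  associator_eqToIso _ _ _ := rfl

instance (i j : RightCell E) : Preadditive (i ⟶ j) :=
  inferInstanceAs (Preadditive (rightCellMor E).FullSubcategory)

instance [Linear k C] (i j : RightCell E) : Linear k (i ⟶ j) :=
  inferInstanceAs (Linear k (rightCellMor E).FullSubcategory)

end RightCell

end RightCell

/-! Write `G j` for the functor by which F_0j acts. Since e_iΛ ⊗_Λ Λe_0 = e_iΛe_0 has dimension 2
for i = 0 and is spanned by the single arrow a_i at a leaf, F_0i ∘ F_0j is a summand of two,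
respectively one, copies of F_0j. Left multiplication by c = b_i a_i on e_0Λ gives an endomorphism α
of F_00 with α² = 0. It factors through F_0j for every leaf j, because c = b_j a_j for all j. As c
is non-zero, the identity of F_0j factors through α applied at F_0j
(`RightCell.exists_sum_proj_comp`, `RightCell.exists_nilpotent`). A 2-representation preserves all
of this.

Suppose there are two non-isomorphic indecomposables. By transitivity, every non-zero G_j X contains
all indecomposables as summands (`retract_obj_of_not_isZero`). Lengths of modules over a finite
dimensional algebra, additive on direct sums, then limit what can occur.

For a leaf j, at most one indecomposable is not killed by G_j: if Z and Z' both survive, then G_j Z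
contains Z ⊕ Z', so G_j G_j Z is longer than G_j Z, although it is a summand of one copy of it. On
the other hand, α is non-zero on some indecomposable Z. The factorizations of α show that no G_j
kills Z, so all other indecomposables are killed by the leaf functors, and α vanishes on them.

Let W be another indecomposable. Then G_0 W is non-zero and G_0 Z = Z ⊕ W ⊕ R. A further copy of Z
in R would make G_0 G_0 Z longer than 2 len(G_0 Z). So Z occurs once, and α at G_0 Z factors through
α_Z. Hence the identity of G_0 Z factors through α_Z, an endomorphism of the same finite length
object. This makes α_Z invertible, against α_Z² = 0. The counting is
`LengthFunction.iso_of_indecomposable`. -/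

/-! ### Length functions on additive categories -/

/-- An additive, monotone and faithful length function on an additive category whose idempotents
split and whose indecomposable objects have local endomorphism rings. -/
structure LengthFunction (A : Type w) [Category.{v} A] [Preadditive A] [HasBinaryBiproducts A] where
  len : A → ℕ
  len_pos : ∀ {X : A}, ¬ IsZero X → 0 < len X
  len_biprod : ∀ X Y : A, len (X ⊞ Y) = len X + len Y
  len_le : ∀ {X Y : A} {m : ℕ} (p : Fin m → (X ⟶ Y)) (q : Fin m → (Y ⟶ X)),
    ∑ t, p t ≫ q t = 𝟙 X → len X ≤ m * len Y
  exists_complement : ∀ {X Y : A}, Retract X Y → ∃ R : A, Nonempty (Y ≅ X ⊞ R)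
  isUnit_or : ∀ {X : A}, Indecomposable X → ∀ f : End X, IsUnit f ∨ IsUnit (1 - f)
  comp_eq_id_symm : ∀ {X : A} (f g : X ⟶ X), f ≫ g = 𝟙 X → g ≫ f = 𝟙 X

namespace LengthFunction

variable {A : Type w} [Category.{v} A] [Preadditive A] [HasBinaryBiproducts A]
  (ℓ : LengthFunction A)

include ℓ

theorem len_le_of_retract {X Y : A} (h : Retract X Y) : ℓ.len X ≤ ℓ.len Y := by
  simpa using ℓ.len_le (m := 1) (fun _ => h.i) (fun _ => h.r) (by simp)

theorem len_eq_of_iso {X Y : A} (e : X ≅ Y) : ℓ.len X = ℓ.len Y :=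
  le_antisymm (ℓ.len_le_of_retract (.ofIso e)) (ℓ.len_le_of_retract (.ofIso e.symm))

/-- The endomorphism ring of an indecomposable object is local, so non-units are closed under finite
sums. -/
theorem isUnit_of_isUnit_sum {X : A} (hX : Indecomposable X) {ι : Type*} (s : Finset ι)
    (f : ι → End X) (h : IsUnit (∑ t ∈ s, f t)) : ∃ t ∈ s, IsUnit (f t) := by
  have : Nontrivial (End X) := ⟨𝟙 X, 0, fun h0 => hX.1 ((IsZero.iff_id_eq_zero X).2 h0)⟩
  have : IsLocalRing (End X) := .of_isUnit_or_isUnit_one_sub_self (ℓ.isUnit_or hX)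
  by_contra! hs
  have : ∀ s' : Finset ι, (∀ t ∈ s', ¬ IsUnit (f t)) → ¬ IsUnit (∑ t ∈ s', f t) := by
    classical
    intro s'
    induction s' using Finset.induction_on with
    | empty => exact fun _ => by rw [Finset.sum_empty]; exact not_isUnit_zero
    | insert a s' ha ih =>
      intro hs' hu
      rw [Finset.sum_insert ha] at hu
      rcases IsLocalRing.isUnit_or_isUnit_of_isUnit_add hu with hu | hu
      · exact hs' a (Finset.mem_insert_self _ _) hu
      · exact ih (fun t ht => hs' t (Finset.mem_insert_of_mem ht)) hu
  exact this s hs h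

/-- An indecomposable object is exchanged: if its identity is a sum of morphisms factoring through
the objects `Y t`, then it is a retract of one of them. -/
theorem exists_retract_of_sum {X : A} (hX : Indecomposable X) {ι : Type*} [Fintype ι] {Y : ι → A}
    (p : ∀ t, X ⟶ Y t) (q : ∀ t, Y t ⟶ X) (h : ∑ t, p t ≫ q t = 𝟙 X) :
    ∃ t, Nonempty (Retract X (Y t)) := by
  obtain ⟨t, -, ht⟩ := ℓ.isUnit_of_isUnit_sum hX Finset.univ (fun t => (p t ≫ q t : End X))
    (by rw [h]; exact isUnit_one)
  obtain ⟨u, hu⟩ := ht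
  refine ⟨t, ⟨⟨p t, q t ≫ (↑u⁻¹ : End X), ?_⟩⟩⟩
  have := u.inv_mul
  rw [hu] at this
  rw [← Category.assoc]
  exact this

theorem retract_biprod {X Y Z : A} (hX : Indecomposable X) (h : Retract X (Y ⊞ Z)) :
    Nonempty (Retract X Y) ∨ Nonempty (Retract X Z) := by
  obtain ⟨t, ht⟩ := ℓ.exists_retract_of_sum hX (Y := fun t : Bool => if t then Y else Z)
    (fun | true => h.i ≫ biprod.fst | false => h.i ≫ biprod.snd)
    (fun | true => biprod.inl ≫ h.r | false => biprod.inr ≫ h.r) (by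
      have := h.retract
      rw [← Category.id_comp h.r, ← biprod.total, Preadditive.add_comp, Preadditive.comp_add] at this
      refine (Fintype.sum_bool _).trans (Eq.trans ?_ this)
      change (h.i ≫ biprod.fst) ≫ biprod.inl ≫ h.r + (h.i ≫ biprod.snd) ≫ biprod.inr ≫ h.r = _
      simp only [Category.assoc])
  cases t
  · exact .inr ht
  · exact .inl ht

/-- A retract has a complement, and indecomposability of Y forces this complement to vanish. -/
theorem iso_of_retract {X Y : A} (hX : Indecomposable X) (hY : Indecomposable Y)
    (h : Retract X Y) : Nonempty (X ≅ Y) := by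
  obtain ⟨R, ⟨e⟩⟩ := ℓ.exists_complement h
  rcases hY.2 _ _ e with h0 | h0
  · exact (hX.1 h0).elim
  · exact ⟨(isoBiprodZero h0).trans e.symm⟩

/-- A property of objects which is invariant under isomorphisms and direct sums and holds for zero
objects and for indecomposable objects that are retracts of `X` holds for `X`. -/
theorem induction_retract {P : A → Prop} (h0 : ∀ X, IsZero X → P X)
    (hiso : ∀ {X Y : A}, (X ≅ Y) → P X → P Y) (hadd : ∀ X Y : A, P X → P Y → P (X ⊞ Y)) (X : A)
    (hind : ∀ Y : A, Indecomposable Y → Nonempty (Retract Y X) → P Y) : P X := by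
  induction hN : ℓ.len X using Nat.strong_induction_on generalizing X with
  | _ N ih =>
    subst hN
    by_cases hz : IsZero X
    · exact h0 X hz
    by_cases hX : Indecomposable X
    · exact hind X hX ⟨Retract.refl X⟩
    obtain ⟨Y, Z, e, hY, hZ⟩ : ∃ (Y Z : A) (_ : X ≅ Y ⊞ Z), ¬ IsZero Y ∧ ¬ IsZero Z := by
      by_contra! h
      exact hX ⟨hz, fun Y Z e => or_iff_not_imp_left.2 (h Y Z e)⟩
    have hl := (ℓ.len_eq_of_iso e).trans (ℓ.len_biprod Y Z)
    have := ℓ.len_pos hY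
    have := ℓ.len_pos hZ
    -- Both summands are non-zero, hence strictly shorter than X, and their indecomposable retracts
    -- are retracts of X.
    refine hiso e.symm (hadd Y Z (ih _ (by lia) Y (fun W hW ⟨r⟩ => hind W hW ⟨?_⟩) rfl)
      (ih _ (by lia) Z (fun W hW ⟨r⟩ => hind W hW ⟨?_⟩) rfl))
    · exact (r.trans ⟨biprod.inl, biprod.fst, by simp⟩).trans (.ofIso e.symm)
    · exact (r.trans ⟨biprod.inr, biprod.snd, by simp⟩).trans (.ofIso e.symm)

theorem exists_indecomposable_retract {X : A} (hX : ¬ IsZero X) :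
    ∃ Y : A, Indecomposable Y ∧ Nonempty (Retract Y X) := by
  by_contra! h
  refine hX (ℓ.induction_retract (P := IsZero) (fun _ h => h) (fun e h => h.of_iso e.symm)
    (fun X Y hX hY => ?_) X fun Y hY hr => ((h Y hY).false hr.some).elim)
  rw [IsZero.iff_id_eq_zero, ← biprod.total, hX.eq_of_tgt biprod.fst 0, hY.eq_of_tgt biprod.snd 0]
  simp

/-- Two non-isomorphic indecomposable retracts of `Z` split off simultaneously. -/
theorem exists_iso_biprod_biprod {X Y Z : A} (hX : Indecomposable X) (hY : Indecomposable Y)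
    (hXY : IsEmpty (X ≅ Y)) (h : Retract X Z) (h' : Retract Y Z) :
    ∃ R : A, Nonempty (Z ≅ X ⊞ (Y ⊞ R)) := by
  obtain ⟨R, ⟨e⟩⟩ := ℓ.exists_complement h
  obtain h1 | h1 := ℓ.retract_biprod hY (h'.trans (.ofIso e))
  · exact (hXY.false (ℓ.iso_of_retract hY hX h1.some).some.symm).elim
  · obtain ⟨R', ⟨e'⟩⟩ := ℓ.exists_complement h1.some
    exact ⟨R', ⟨e ≪≫ biprod.mapIso (Iso.refl X) e'⟩⟩

theorem len_obj_biprod (G : A ⥤ A) [G.Additive] (X Y : A) :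
    ℓ.len (G.obj (X ⊞ Y)) = ℓ.len (G.obj X) + ℓ.len (G.obj Y) := by
  have := preservesBinaryBiproducts_of_preservesBinaryProducts G
  rw [ℓ.len_eq_of_iso (G.mapBiprod X Y), ℓ.len_biprod]

-- Naturality makes α diagonal on a direct sum. This lets α be tested on indecomposable summands.
omit ℓ in
theorem app_biprod (G H : A ⥤ A) [G.Additive] (α : G ⟶ H) (X Y : A) :
    α.app (X ⊞ Y) = G.map biprod.fst ≫ α.app X ≫ H.map biprod.inl +
      G.map biprod.snd ≫ α.app Y ≫ H.map biprod.inr := by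
  have : α.app (X ⊞ Y) = G.map (𝟙 _) ≫ α.app (X ⊞ Y) := by simp
  rw [this, ← biprod.total, G.map_add, Preadditive.add_comp]
  simp

omit ℓ [HasBinaryBiproducts A] in
theorem isZero_obj (G : A ⥤ A) [G.Additive] {X : A} (hX : IsZero X) : IsZero (G.obj X) := by
  rw [IsZero.iff_id_eq_zero] at hX ⊢
  rw [← G.map_id, hX, G.map_zero]

/-- A natural transformation of additive functors which vanishes on all indecomposable retracts of
`X` vanishes on `X`. -/
theorem app_eq_zero (G H : A ⥤ A) [G.Additive] (α : G ⟶ H) (X : A)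
    (h : ∀ Y : A, Indecomposable Y → Nonempty (Retract Y X) → α.app Y = 0) : α.app X = 0 := by
  refine ℓ.induction_retract (P := fun X => α.app X = 0)
    (fun X hX => (isZero_obj G hX).eq_of_src _ _) (fun {X Y} e hX => ?_)
    (fun X Y hX hY => by rw [app_biprod, hX, hY]; simp) X h
  rw [← cancel_epi (G.map e.hom), α.naturality, hX, comp_zero, zero_comp]

/-! ### The counting argument for uniqueness of the indecomposable object -/

section Uniqueness

variable {n : ℕ} (G : Fin (n + 1) → (A ⥤ A)) [∀ j, (G j).Additive]

omit [∀ j, (G j).Additive] in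
/-- If the additive functors `G j` act transitively, then every indecomposable object occurs in every
non-zero `G j X`. -/
theorem retract_obj_of_not_isZero
    (htrans : ∀ X Y : A, Indecomposable X → Indecomposable Y →
      Nonempty (Retract Y X) ∨ ∃ j, Nonempty (Retract Y ((G j).obj X)))
    (m : Fin (n + 1) → ℕ)
    (hcomp : ∀ i j X, ∃ (p : Fin (m i) → ((G i).obj ((G j).obj X) ⟶ (G j).obj X))
      (q : Fin (m i) → ((G j).obj X ⟶ (G i).obj ((G j).obj X))), ∑ t, p t ≫ q t = 𝟙 _)
    {j : Fin (n + 1)} {X : A} (h : ¬ IsZero ((G j).obj X)) {Y : A} (hY : Indecomposable Y) :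
    Nonempty (Retract Y ((G j).obj X)) := by
  -- Transitivity is applied to a summand Z of G_j X. If Y lies in G_i Z, then it lies in G_i G_j X,
  -- hence in finitely many copies of G_j X, and the exchange property places it in one of them.
  obtain ⟨Z, hZ, ⟨r⟩⟩ := ℓ.exists_indecomposable_retract h
  obtain ⟨⟨s⟩⟩ | ⟨i, ⟨s⟩⟩ := htrans Z Y hZ hY
  · exact ⟨s.trans r⟩
  · obtain ⟨p, q, hpq⟩ := hcomp i j X
    let s' := s.trans (r.map (G i))
    obtain ⟨-, ht⟩ := ℓ.exists_retract_of_sum hY (Y := fun _ => (G j).obj X)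
      (fun t => s'.i ≫ p t) (fun t => q t ≫ s'.r) (by
        have := s'.retract
        rw [← Category.id_comp s'.r, ← hpq, Preadditive.sum_comp, Preadditive.comp_sum] at this
        simpa only [Category.assoc] using this)
    exact ht

/-- If the additive functors `G j` act transitively and satisfy the relations of the functors `F_0j`,
where `α` is the nilpotent endomorphism of `F_00`, then all indecomposable objects are isomorphic. -/
theorem iso_of_indecomposable (hn : 1 ≤ n)
    (htrans : ∀ X Y : A, Indecomposable X → Indecomposable Y →
      Nonempty (Retract Y X) ∨ ∃ j, Nonempty (Retract Y ((G j).obj X)))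
    (m : Fin (n + 1) → ℕ) (hm0 : m 0 ≤ 2) (hm : ∀ j, j ≠ 0 → m j ≤ 1)
    (hcomp : ∀ i j X, ∃ (p : Fin (m i) → ((G i).obj ((G j).obj X) ⟶ (G j).obj X))
      (q : Fin (m i) → ((G j).obj X ⟶ (G i).obj ((G j).obj X))), ∑ t, p t ≫ q t = 𝟙 _)
    (α : G 0 ⟶ G 0) (hα : ∀ X, α.app X ≫ α.app X = 0)
    (hfac : ∀ j, j ≠ 0 → ∃ (β : G 0 ⟶ G j) (γ : G j ⟶ G 0), α = β ≫ γ)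
    (hunit : ∀ j X, ∃ (p : (G j).obj X ⟶ (G 0).obj ((G j).obj X))
      (q : (G 0).obj ((G j).obj X) ⟶ (G j).obj X), p ≫ α.app ((G j).obj X) ≫ q = 𝟙 _)
    {X Y : A} (hX : Indecomposable X) (hY : Indecomposable Y) : Nonempty (X ≅ Y) := by
  by_contra hXY
  have hlen : ∀ i j X, ℓ.len ((G i).obj ((G j).obj X)) ≤ m i * ℓ.len ((G j).obj X) := by
    intro i j X
    obtain ⟨p, q, h⟩ := hcomp i j X
    exact ℓ.len_le p q h
  have hex : ∀ Z : A, Indecomposable Z → ∃ Z' : A, Indecomposable Z' ∧ IsEmpty (Z ≅ Z') := by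
    intro Z hZ
    by_contra! h
    exact hXY ⟨(h X hX).some.symm ≪≫ (h Y hY).some⟩
  -- A second indecomposable Z' can be reached from Z only through some G_j, so not all G_j kill Z.
  have hnz : ∀ Z : A, Indecomposable Z → ∃ j, ¬ IsZero ((G j).obj Z) := by
    intro Z hZ
    obtain ⟨Z', hZ', he⟩ := hex Z hZ
    obtain ⟨⟨s⟩⟩ | ⟨j, ⟨s⟩⟩ := htrans Z Z' hZ hZ'
    · exact (he.false (ℓ.iso_of_retract hZ' hZ s).some.symm).elim
    · refine ⟨j, fun h0 => hZ'.1 ?_⟩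
      rw [IsZero.iff_id_eq_zero, ← s.retract, h0.eq_of_tgt s.i 0, zero_comp]
  have huniq : ∀ j, j ≠ 0 → ∀ Z Z' : A, Indecomposable Z → Indecomposable Z' →
      ¬ IsZero ((G j).obj Z) → ¬ IsZero ((G j).obj Z') → Nonempty (Z ≅ Z') := by
    intro j hj Z Z' hZ hZ' h h'
    by_contra! he
    obtain ⟨R, ⟨e⟩⟩ := ℓ.exists_iso_biprod_biprod hZ hZ' he
      (ℓ.retract_obj_of_not_isZero G htrans m hcomp h hZ).some
      (ℓ.retract_obj_of_not_isZero G htrans m hcomp h hZ').some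
    -- G_j G_j Z has length at least len(G_j Z) + len(G_j Z') by the decomposition, but at most
    -- len(G_j Z) because m_j ≤ 1.
    have h1 := ℓ.len_eq_of_iso ((G j).mapIso e)
    rw [ℓ.len_obj_biprod, ℓ.len_obj_biprod] at h1
    have h2 := (hlen j j Z).trans (Nat.mul_le_mul_right _ (hm j hj))
    have := ℓ.len_pos h'
    lia
  -- If α vanished on all indecomposables it would vanish everywhere, while the identity of a
  -- non-zero G_j X factors through it.
  obtain ⟨Z, hZ, hαZ⟩ : ∃ Z : A, Indecomposable Z ∧ α.app Z ≠ 0 := by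
    by_contra! h
    obtain ⟨j, hj⟩ := hnz X hX
    obtain ⟨p, q, hpq⟩ := hunit j X
    refine hj ((IsZero.iff_id_eq_zero _).2 ?_)
    rw [← hpq, ℓ.app_eq_zero _ _ α _ fun Y hY _ => h Y hY]
    simp
  have hGZ : ∀ j, ¬ IsZero ((G j).obj Z) := by
    intro j h0
    by_cases hj : j = 0
    · subst hj
      exact hαZ (h0.eq_of_src _ _)
    · obtain ⟨β, γ, hβγ⟩ := hfac j hj
      apply hαZ
      rw [hβγ, NatTrans.comp_app, h0.eq_of_tgt (β.app Z) 0, zero_comp]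
  have hother : ∀ W : A, Indecomposable W → IsEmpty (Z ≅ W) → ∀ j, j ≠ 0 → IsZero ((G j).obj W) := by
    intro W hW he j hj
    by_contra h0
    exact he.false (huniq j hj Z W hZ hW (hGZ j) h0).some
  have hαother : ∀ W : A, Indecomposable W → IsEmpty (Z ≅ W) → α.app W = 0 := by
    intro W hW he
    -- Any leaf serves here; one exists because n ≥ 1.
    have h1 : (Fin.last n) ≠ 0 := fun h => Nat.one_le_iff_ne_zero.1 hn (congrArg Fin.val h)
    obtain ⟨β, γ, hβγ⟩ := hfac _ h1
    rw [hβγ, NatTrans.comp_app, (hother W hW he _ h1).eq_of_tgt (β.app W) 0, zero_comp]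
  obtain ⟨W, hW, he⟩ := hex Z hZ
  have hGW : ¬ IsZero ((G 0).obj W) := by
    obtain ⟨j, hj⟩ := hnz W hW
    by_cases hj0 : j = 0
    · rwa [← hj0]
    · exact (hj (hother W hW he j hj0)).elim
  obtain ⟨R, ⟨e⟩⟩ := ℓ.exists_iso_biprod_biprod hZ hW he
    (ℓ.retract_obj_of_not_isZero G htrans m hcomp (hGZ 0) hZ).some
    (ℓ.retract_obj_of_not_isZero G htrans m hcomp (hGZ 0) hW).some
  have hlW := ℓ.len_pos hGW
  have hVV := (hlen 0 0 Z).trans (Nat.mul_le_mul_right _ hm0)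
  have h1 := ℓ.len_eq_of_iso ((G 0).mapIso e)
  simp only [ℓ.len_obj_biprod] at h1
  -- A second copy of Z would have to lie in R, so that len(G_0 G_0 Z) ≥ 2 len(G_0 Z) + len(G_0 W),
  -- which exceeds the bound 2 len(G_0 Z).
  by_cases hr : Nonempty (Retract Z (W ⊞ R))
  · obtain hr | ⟨⟨r⟩⟩ := ℓ.retract_biprod hZ hr.some
    · exact he.false (ℓ.iso_of_retract hZ hW hr.some).some
    · have := ℓ.len_le_of_retract (r.map (G 0))
      lia
  · have hαR : α.app (W ⊞ R) = 0 := by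
      refine ℓ.app_eq_zero _ _ α _ fun U hU hUR => hαother U hU ⟨fun f => hr ?_⟩
      exact ⟨(Retract.ofIso f).trans hUR.some⟩
    obtain ⟨p, q, hpq⟩ := hunit 0 Z
    -- Only the single summand Z contributes to α at G_0 Z, since α vanishes on W ⊕ R.
    have hαV : α.app ((G 0).obj Z) = ((G 0).map e.hom ≫ (G 0).map biprod.fst) ≫ α.app Z ≫
        (G 0).map biprod.inl ≫ (G 0).map e.inv := by
      have h2 : α.app ((G 0).obj Z) = (G 0).map e.hom ≫ α.app _ ≫ (G 0).map e.inv := by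
        rw [← Category.assoc, α.naturality, Category.assoc, ← Functor.map_comp, e.hom_inv_id]
        simp
      rw [h2, app_biprod, hαR]
      simp
    obtain ⟨P, Q, hPQ⟩ : ∃ P Q : (G 0).obj Z ⟶ (G 0).obj Z, (P ≫ α.app Z) ≫ Q = 𝟙 _ :=
      ⟨p ≫ (G 0).map e.hom ≫ (G 0).map biprod.fst,
        ((G 0).map biprod.inl ≫ (G 0).map e.inv) ≫ q, by
          rw [← hpq, hαV]; simp only [Category.assoc]⟩
    -- One-sided inverses of endomorphisms are two-sided by finite length. Thus Q ≫ P is a left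
    -- inverse of α_Z, and composing it with α_Z² = 0 gives α_Z = 0.
    have h3 := ℓ.comp_eq_id_symm _ _ hPQ
    have h4 : α.app Z = 0 := by
      rw [← Category.id_comp (α.app Z), ← h3]
      simp only [Category.assoc, hα, comp_zero]
    exact hαZ h4

end Uniqueness

end LengthFunction

/-! ### The length function of a finitary category -/

/-- The maps `p t` together embed M into N^m. -/
theorem Module.length_le_nsmul_of_sum_comp_eq_id {B : Type*} [Ring B] {M N : Type*}
    [AddCommGroup M] [Module B M] [AddCommGroup N] [Module B N] {m : ℕ} (p : Fin m → (M →ₗ[B] N))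
    (q : Fin m → (N →ₗ[B] M)) (h : ∑ t, q t ∘ₗ p t = LinearMap.id) :
    Module.length B M ≤ m * Module.length B N := by
  have := Module.length_le_of_injective (LinearMap.pi p) (fun x y hxy => by
    rw [← LinearMap.id_apply (R := B) x, ← LinearMap.id_apply (R := B) y, ← h]
    simp only [LinearMap.sum_apply, LinearMap.comp_apply]
    exact Finset.sum_congr rfl fun t _ => congrArg _ (congrFun hxy t))
  rwa [Module.length_pi_of_fintype, Finset.sum_const, Finset.card_univ, Fintype.card_fin,
    nsmul_eq_mul] at this

instance FGProj.isIdempotentComplete (B : Type u) [Ring B] : IsIdempotentComplete (FGProj B) where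
  idempotents_split X p hp := by
    obtain ⟨M, hM, hM'⟩ := X
    have hp' : ∀ x, p.hom.hom (p.hom.hom x) = p.hom.hom x := fun x => by
      conv_rhs => rw [← hp]
      rfl
    let π := p.hom.hom.rangeRestrict
    have hπ : π ∘ₗ (LinearMap.range p.hom.hom).subtype = LinearMap.id := by
      ext ⟨_, x, rfl⟩
      exact hp' x
    exact ⟨⟨ModuleCat.of B (LinearMap.range p.hom.hom),
      Module.Finite.of_surjective π p.hom.hom.surjective_rangeRestrict,
      Module.Projective.of_split _ π hπ⟩, ObjectProperty.homMk (ModuleCat.ofHom (Submodule.subtype _)),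
      ObjectProperty.homMk (ModuleCat.ofHom π), by ext : 2; exact hπ, rfl⟩

/-! ### Splitting idempotents, and the length function of modules -/

section

variable {A : Type w} [Category.{v} A] [Preadditive A] [HasBinaryBiproducts A]

theorem exists_iso_biprod_of_retract [IsIdempotentComplete A] {X Y : A} (h : Retract X Y) :
    ∃ R : A, Nonempty (Y ≅ X ⊞ R) := by
  have hp : (h.r ≫ h.i) ≫ h.r ≫ h.i = h.r ≫ h.i := by simp
  obtain ⟨R, i, e, hie, hei⟩ := IsIdempotentComplete.idempotents_split Y (𝟙 Y - h.r ≫ h.i)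
    (Idempotents.idem_of_id_sub_idem _ hp)
  have h1 : h.i ≫ e = 0 := by
    rw [← Category.comp_id e, ← hie, ← Category.assoc e, hei]
    simp
  have h2 : i ≫ h.r = 0 := by
    rw [← Category.id_comp i, ← hie, Category.assoc i, hei]
    simp
  refine ⟨R, ⟨⟨biprod.lift h.r e, biprod.desc h.i i, ?_, ?_⟩⟩⟩
  · rw [biprod.lift_desc, hei]
    abel
  · ext <;> simp [h1, h2, hie]

/-- Splitting p and 1 - p writes X as a direct sum, one summand of which must vanish. -/
theorem CategoryTheory.Indecomposable.eq_zero_or_eq_id [IsIdempotentComplete A] {X : A}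
    (hX : Indecomposable X) (p : X ⟶ X) (hp : p ≫ p = p) : p = 0 ∨ p = 𝟙 X := by
  obtain ⟨Y, i, e, hie, hei⟩ := IsIdempotentComplete.idempotents_split X p hp
  obtain ⟨R, i', e', hie', hei'⟩ := IsIdempotentComplete.idempotents_split X (𝟙 X - p)
    (Idempotents.idem_of_id_sub_idem _ hp)
  have h1 : i ≫ e' = 0 := by
    rw [← Category.comp_id e', ← hie', ← Category.assoc e', hei', ← hei]
    simp [reassoc_of% hie]
  have h2 : i' ≫ e = 0 := by
    rw [← Category.id_comp i', ← hie', Category.assoc i', hei', ← hei]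
    simp [hie]
  rcases hX.2 Y R ⟨biprod.lift e e', biprod.desc i i', by
    rw [biprod.lift_desc, hei, hei']; abel, by ext <;> simp [h1, h2, hie, hie']⟩ with h0 | h0
  · left
    rw [← hei, h0.eq_of_tgt e 0, zero_comp]
  · right
    rw [eq_comm, ← sub_eq_zero, ← hei', h0.eq_of_tgt e' 0, zero_comp]

/-- A category which is equivalent to the category of finitely generated projective modules over an
artinian ring has a length function. -/
noncomputable def LengthFunction.ofEquivalence {B : Type u} [Ring B] [IsArtinianRing B]
    (e : A ≌ FGProj B) [e.functor.Additive] : LengthFunction A :=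
  have : IsIdempotentComplete A := by
    rw [Idempotents.isIdempotentComplete_iff_of_equivalence e]
    infer_instance
  let Φ : A ⥤ ModuleCat.{u} B := e.functor ⋙ ObjectProperty.ι _
  have hΦ : Φ.Additive := inferInstance
  have hf : ∀ X, Module.Finite B (Φ.obj X) := fun X => (e.functor.obj X).property.1
  have hfin : ∀ X, Module.length B (Φ.obj X) ≠ ⊤ := fun X => Module.length_ne_top
  have hle : ∀ {X Y : A} {m : ℕ} (p : Fin m → (X ⟶ Y)) (q : Fin m → (Y ⟶ X)),
      ∑ t, p t ≫ q t = 𝟙 X → (Module.length B (Φ.obj X)).toNat ≤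
        m * (Module.length B (Φ.obj Y)).toNat := by
    intro X Y m p q h
    have := Module.length_le_nsmul_of_sum_comp_eq_id (fun t => (Φ.map (p t)).hom)
      (fun t => (Φ.map (q t)).hom) (by
        have := congrArg (fun f => (Φ.map f).hom) h
        simpa [Functor.map_sum, ModuleCat.hom_sum] using this)
    rw [← ENat.natCast_toNat (hfin X), ← ENat.natCast_toNat (hfin Y)] at this
    exact_mod_cast this
  have hbij : ∀ {X : A} (f : X ⟶ X), Function.Bijective (Φ.map f).hom → IsIso f := by
    intro X f h
    have : IsIso (Φ.map f) := (ConcreteCategory.isIso_iff_bijective (Φ.map f)).2 h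
    exact isIso_of_reflects_iso f Φ
  { len := fun X => (Module.length B (Φ.obj X)).toNat
    len_pos := fun {X} hX => by
      rw [Nat.pos_iff_ne_zero, Ne, ENat.toNat_eq_zero, not_or]
      refine ⟨fun h => hX ?_, hfin X⟩
      rw [IsZero.iff_id_eq_zero]
      apply Φ.map_injective
      have := Module.length_eq_zero_iff.1 h
      ext x
      exact Subsingleton.elim _ _
    len_biprod := fun X Y => by
      have h1 := Module.length_eq_add_of_exact (R := B) (Φ.map (biprod.inl : X ⟶ X ⊞ Y)).hom
        (Φ.map (biprod.snd : X ⊞ Y ⟶ Y)).hom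
        (Function.LeftInverse.injective (g := (Φ.map (biprod.fst : X ⊞ Y ⟶ X)).hom) fun x => by
          rw [← ModuleCat.comp_apply, ← Φ.map_comp, biprod.inl_fst, Φ.map_id]; rfl)
        (Function.RightInverse.surjective (g := (Φ.map (biprod.inr : Y ⟶ X ⊞ Y)).hom) fun x => by
          rw [← ModuleCat.comp_apply, ← Φ.map_comp, biprod.inr_snd, Φ.map_id]; rfl)
        (fun x => ⟨fun hx => ⟨(Φ.map (biprod.fst : X ⊞ Y ⟶ X)).hom x, by
          have h2 : (Φ.map (𝟙 (X ⊞ Y))).hom x = x := by rw [Φ.map_id]; rfl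
          rw [← biprod.total, Φ.map_add, Φ.map_comp, Φ.map_comp] at h2
          change (Φ.map biprod.inl).hom ((Φ.map biprod.fst).hom x) +
            (Φ.map biprod.inr).hom ((Φ.map biprod.snd).hom x) = x at h2
          rwa [hx, map_zero, add_zero] at h2⟩, by
          rintro ⟨y, rfl⟩
          rw [← ModuleCat.comp_apply, ← Φ.map_comp, biprod.inl_snd, Φ.map_zero]; rfl⟩)
      rw [h1, ENat.toNat_add (hfin X) (hfin Y)]
    len_le := hle
    exists_complement := exists_iso_biprod_of_retract
    isUnit_or := fun {X} hX f => by
      let φ : Module.End B (Φ.obj X) := (Φ.map f).hom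
      have hpow : ∀ n : ℕ, (Φ.map (f ^ n : End X)).hom = φ ^ n := fun n => by
        have := map_pow (Φ.mapEnd X) f n
        refine (congrArg ModuleCat.Hom.hom this).trans ?_
        exact map_pow (ModuleCat.endRingEquiv (Φ.obj X)) (Φ.mapEnd X f) n
      -- Fitting's lemma: the projection onto ker φ^(N+1) along the range of φ^(N+1) is 0 or 1, so φ
      -- is injective or nilpotent. The exponent N + 1 is positive, so that ker φ is contained in
      -- this kernel.
      obtain ⟨N, hN⟩ := Filter.eventually_atTop.1 φ.eventually_isCompl_ker_pow_range_pow
      have hc := hN (N + 1) (by lia)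
      let P := Submodule.projection _ _ hc
      have hP : P ∘ₗ P = P := Submodule.isIdempotentElem_projection hc
      rcases hX.eq_zero_or_eq_id (Φ.preimage (ModuleCat.ofHom P)) (Φ.map_injective (by
        rw [Φ.map_comp, Φ.map_preimage, ← ModuleCat.ofHom_comp, hP])) with h0 | h1
      · left
        have h2 : P = 0 := by
          have := congrArg (fun f => (Φ.map f).hom) h0
          simpa using this
        have h3 := Submodule.range_projection hc
        change LinearMap.range P = _ at h3
        rw [h2, LinearMap.range_zero] at h3
        have h4 : Function.Injective φ := by
          rw [← LinearMap.ker_eq_bot, eq_bot_iff, h3, pow_succ]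
          exact LinearMap.ker_le_ker_comp _ _
        exact (isUnit_iff_isIso _).2 (hbij f (IsArtinian.bijective_of_injective_endomorphism φ h4))
      · right
        have h2 : P = LinearMap.id := by
          have := congrArg (fun f => (Φ.map f).hom) h1
          simpa using this
        have h3 := Submodule.range_projection hc
        change LinearMap.range P = _ at h3
        rw [h2, LinearMap.range_id, eq_comm, LinearMap.ker_eq_top, ← hpow] at h3
        refine IsNilpotent.isUnit_one_sub ⟨N + 1, Φ.map_injective (ModuleCat.hom_ext ?_)⟩
        rw [h3]
        exact (congrArg ModuleCat.Hom.hom (Φ.map_zero X X)).symm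
    comp_eq_id_symm := fun {X} f g h => by
      -- A split monomorphism is injective on modules, and injective endomorphisms of artinian
      -- modules are bijective.
      have : IsIso f := hbij f (IsArtinian.bijective_of_injective_endomorphism _
        (Function.LeftInverse.injective (g := (Φ.map g).hom) fun x => by
          rw [← ModuleCat.comp_apply, ← Φ.map_comp, h, Φ.map_id]; rfl))
      rw [← IsIso.inv_eq_of_hom_inv_id h, IsIso.inv_hom_id] }

end

theorem FinitaryCat.nonempty_lengthFunction {k : Type u} [Field k] (A : FinitaryCat.{u, w, v} k) :
    Nonempty (LengthFunction A) := by
  obtain ⟨B, _, _, _, e, _, -⟩ := A.finitary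
  have : IsArtinianRing B := IsArtinianRing.of_finite k B
  exact ⟨.ofEquivalence e⟩

namespace StarAlg

section

variable (k : Type u) [Field k] (n : ℕ)

/-! ### The paths starting at the centre -/

/-- The action of the generators on the projective module `Λ e_0`: the first two coordinates belong to
the paths `e_0` and `b_i a_i`, the other ones to the arrows `a_i`. -/
def Gen.act : Gen n → Module.End k (k × k × (Fin n → k))
  | .vertex j => Fin.cases
      { toFun := fun x => (x.1, x.2.1, 0)
        map_add' := fun x y => by simp
        map_smul' := fun c x => by simp }
      (fun i =>
      { toFun := fun x => (0, 0, Pi.single i (x.2.2 i))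
        map_add' := fun x y => by simp [Pi.single_add]
        map_smul' := fun c x => Prod.ext (by simp) (Prod.ext (by simp) (Pi.single_smul i c _)) }) j
  | .a i =>
      { toFun := fun x => (0, 0, Pi.single i x.1)
        map_add' := fun x y => by simp [Pi.single_add]
        map_smul' := fun c x => Prod.ext (by simp) (Prod.ext (by simp) (Pi.single_smul i c _)) }
  | .b i =>
      { toFun := fun x => (0, x.2.2 i, 0)
        map_add' := fun x y => by simp
        map_smul' := fun c x => by simp }

@[simp] theorem Gen.act_zero (x : k × k × (Fin n → k)) :
    Gen.act k n (.vertex 0) x = (x.1, x.2.1, 0) := rfl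

@[simp] theorem Gen.act_succ (i : Fin n) (x : k × k × (Fin n → k)) :
    Gen.act k n (.vertex i.succ) x = (0, 0, Pi.single i (x.2.2 i)) := rfl

@[simp] theorem Gen.act_a (i : Fin n) (x : k × k × (Fin n → k)) :
    Gen.act k n (.a i) x = (0, 0, Pi.single i x.1) := rfl

@[simp] theorem Gen.act_b (i : Fin n) (x : k × k × (Fin n → k)) :
    Gen.act k n (.b i) x = (0, x.2.2 i, 0) := rfl

/-- The representation of `Λ_n` on `Λ e_0`. -/
noncomputable def centreRep : Alg k n →ₐ[k] Module.End k (k × k × (Fin n → k)) :=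
  RingQuot.liftAlgHom k ⟨FreeAlgebra.lift k (Gen.act k n), by
    intro x y h
    induction h with
    | e_mul_e i j =>
      refine LinearMap.ext fun x => ?_
      simp only [Gen.e', map_mul, FreeAlgebra.lift_ι_apply, Module.End.mul_apply]
      cases i using Fin.cases with
      | zero => cases j using Fin.cases with
        | zero => simp
        | succ j => simp [(Fin.succ_ne_zero j).symm]
      | succ i => cases j using Fin.cases with
        | zero => simp
        | succ j =>
          by_cases h : i = j
          · subst h; simp
          · simp [h]
    | sum_e =>
      refine LinearMap.ext fun x => ?_
      simp only [Gen.e', map_sum, FreeAlgebra.lift_ι_apply, LinearMap.sum_apply, map_one]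
      rw [Fin.sum_univ_succ]
      ext t <;> simp [Prod.fst_sum, Prod.snd_sum, Finset.sum_apply, Pi.single_apply]
    | a_mem i =>
      refine LinearMap.ext fun x => ?_
      simp [Gen.e', Gen.a']
    | b_mem i =>
      refine LinearMap.ext fun x => ?_
      simp [Gen.e', Gen.b']
    | aba h i =>
      refine LinearMap.ext fun x => ?_
      simp [Gen.a', Gen.b']
    | bab h i =>
      refine LinearMap.ext fun x => ?_
      simp [Gen.a', Gen.b']
    | ba h i j =>
      refine LinearMap.ext fun x => ?_
      simp [Gen.a', Gen.b']
    | ab h i j hij =>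
      refine LinearMap.ext fun x => ?_
      simp [Gen.a', Gen.b']⟩

/-- In the representation on Λe_0, the vector (1, 0, 0) standing for e_0 is sent to the basis vector
standing for b_i a_i. -/
theorem b_mul_a_ne_zero (i : Fin n) : b k n i * a k n i ≠ 0 := by
  intro h
  have h1 : ∀ g, centreRep k n (mk k n (FreeAlgebra.ι k g)) = Gen.act k n g := fun g => by
    refine (RingQuot.liftAlgHom_mkAlgHom_apply k _ _ _).trans ?_
    simp
  have := congrArg (fun f => (centreRep k n f (1, 0, 0)).2.1) h
  simp only [map_mul, a, b, Gen.a', Gen.b', h1] at this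
  simp at this

theorem b_mul_a_eq (i j : Fin n) : b k n i * a k n i = b k n j * a k n j := by
  by_cases h : i = j
  · rw [h]
  · exact ba_eq k n (by have := Fin.val_ne_of_ne h; lia) i j

/-- Among the spanning paths only e_0 and the loops b_j a_j start and end at the centre, and these
loops all coincide. -/
theorem e_mul_mul_e_zero_mem_span (i : Fin n) (x : Alg k n) :
    e k n 0 * x * e k n 0 ∈ Submodule.span k
      (Set.range (![e k n 0, b k n i * a k n i] : Fin 2 → Alg k n)) := by
  have hx : x ∈ Submodule.span k (Set.range (spanning k n)) := by
    rw [span_spanning]; trivial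
  have h0 := Submodule.zero_mem (Submodule.span k
    (Set.range (![e k n 0, b k n i * a k n i] : Fin 2 → Alg k n)))
  induction hx using Submodule.span_induction with
  | zero => simp
  | add x y _ _ hx hy => rw [mul_add, add_mul]; exact Submodule.add_mem _ hx hy
  | smul c x _ hx => rw [mul_smul_comm, smul_mul_assoc]; exact Submodule.smul_mem _ c hx
  | mem x hx =>
    obtain ⟨s, rfl⟩ := hx
    rcases s with j | j | j | j | j <;> simp only [spanning]
    · rw [e_mul_e]
      split_ifs
      · rw [e_mul_e, if_pos rfl]; exact Submodule.subset_span ⟨0, rfl⟩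
      · rw [zero_mul]; exact h0
    · rw [e_mul_a, if_neg (Fin.succ_ne_zero j).symm, zero_mul]; exact h0
    · rw [mul_assoc, b_mul_e, if_neg (Fin.succ_ne_zero j).symm, mul_zero]; exact h0
    · rw [← mul_assoc, e_mul_a, if_neg (Fin.succ_ne_zero j).symm, zero_mul, zero_mul]; exact h0
    · rw [← mul_assoc, e_mul_b, if_pos rfl, mul_assoc, a_mul_e, if_pos rfl, b_mul_a_eq k n j i]
      exact Submodule.subset_span ⟨1, rfl⟩

theorem e_succ_mul_mul_e_zero_mem_span (i : Fin n) (x : Alg k n) :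
    e k n i.succ * x * e k n 0 ∈ Submodule.span k
      (Set.range (![a k n i] : Fin 1 → Alg k n)) := by
  have hx : x ∈ Submodule.span k (Set.range (spanning k n)) := by
    rw [span_spanning]; trivial
  have h0 := Submodule.zero_mem (Submodule.span k
    (Set.range (![a k n i] : Fin 1 → Alg k n)))
  induction hx using Submodule.span_induction with
  | zero => simp
  | add x y _ _ hx hy => rw [mul_add, add_mul]; exact Submodule.add_mem _ hx hy
  | smul c x _ hx => rw [mul_smul_comm, smul_mul_assoc]; exact Submodule.smul_mem _ c hx
  | mem x hx =>
    obtain ⟨s, rfl⟩ := hx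
    rcases s with j | j | j | j | j <;> simp only [spanning]
    · rw [e_mul_e]
      split_ifs
      · rw [e_mul_e, if_neg (Fin.succ_ne_zero i)]; exact h0
      · rw [zero_mul]; exact h0
    · rw [e_mul_a]
      split_ifs with h
      · rw [a_mul_e, if_pos rfl, ← Fin.succ_injective _ h]; exact Submodule.subset_span ⟨0, rfl⟩
      · rw [zero_mul]; exact h0
    · rw [mul_assoc, b_mul_e, if_neg (Fin.succ_ne_zero j).symm, mul_zero]; exact h0
    · rw [mul_assoc, mul_assoc, b_mul_e, if_neg (Fin.succ_ne_zero j).symm, mul_zero, mul_zero]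
      exact h0
    · rw [← mul_assoc, e_mul_b, if_neg (Fin.succ_ne_zero i), zero_mul, zero_mul]; exact h0

/-- Over a field, coordinates of the elements of the span of a finite family extend to linear forms. -/
theorem exists_coord_of_span {V : Type*} [AddCommGroup V] [Module k V] {m : ℕ} (c : Fin m → V) :
    ∃ φ : Fin m → (V →ₗ[k] k), ∀ w ∈ Submodule.span k (Set.range c), ∑ t, φ t w • c t = w := by
  let f := Fintype.linearCombination k c
  -- A section of the surjection from k^m onto the span, extended to V. The family need not be
  -- independent.
  obtain ⟨g, hg⟩ := f.rangeRestrict.exists_rightInverse_of_surjective f.range_rangeRestrict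
  obtain ⟨h, hh⟩ := LinearMap.exists_extend g
  refine ⟨fun t => LinearMap.proj t ∘ₗ h, fun w hw => ?_⟩
  have hw' : w ∈ LinearMap.range f := by rwa [Fintype.range_linearCombination]
  have h1 : h w = g ⟨w, hw'⟩ := LinearMap.congr_fun hh ⟨w, hw'⟩
  have h2 := congrArg Subtype.val (LinearMap.congr_fun hg ⟨w, hw'⟩)
  change f (g ⟨w, hw'⟩) = w at h2
  rwa [← h1, Fintype.linearCombination_apply] at h2

/-- The number of paths from the centre to the vertex `j`, that is, the dimension of `e_j Λ e_0`. -/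
def centreDim (j : Fin (n + 1)) : ℕ := if j = 0 then 2 else 1

/-- The choice of c and φ expresses that e_jΛe_0 has dimension at most `centreDim n j`. This upper
bound is all that is needed to split F_0j ∘ F_00 and its analogues into few copies. -/
theorem exists_coord (hn : 1 ≤ n) (j : Fin (n + 1)) :
    ∃ (c : Fin (centreDim n j) → Alg k n) (φ : Fin (centreDim n j) → (Alg k n →ₗ[k] k)),
      ∀ x, ∑ t, φ t (e k n j * x * e k n 0) • c t = e k n j * x * e k n 0 := by
  cases j using Fin.cases with
  | zero =>
    obtain ⟨φ, hφ⟩ := exists_coord_of_span k ![e k n 0, b k n ⟨0, hn⟩ * a k n ⟨0, hn⟩]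
    exact ⟨_, φ, fun x => hφ _ (e_mul_mul_e_zero_mem_span k n _ x)⟩
  | succ i =>
    obtain ⟨φ, hφ⟩ := exists_coord_of_span k ![a k n i]
    have : centreDim n i.succ = 1 := if_neg (Fin.succ_ne_zero i)
    rw [this]
    exact ⟨_, φ, fun x => hφ _ (e_succ_mul_mul_e_zero_mem_span k n _ x)⟩

end

end StarAlg

/-! ### Natural transformations between projective functors -/

namespace StarAlg

section

variable {k : Type u} [Field k] {n : ℕ}

/-- The generator `e_i` of the right ideal `e_i Λ`. -/
noncomputable def rightGen (k : Type u) [Field k] {n : ℕ} (i : Fin (n + 1)) : RightProj k n i :=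
  ⟨e k n i, Submodule.subset_span rfl⟩

theorem e_mul_coe {i : Fin (n + 1)} (y : RightProj k n i) : e k n i * (y : Alg k n) = y := by
  obtain ⟨y, hy⟩ := y
  obtain ⟨x, rfl⟩ := Submodule.mem_span_singleton.1 hy
  change e k n i * (e k n i * x.unop) = e k n i * x.unop
  rw [← mul_assoc, e_mul_e, if_pos rfl]

theorem coe_mul_e {i : Fin (n + 1)} (z : LeftProj k n i) : (z : Alg k n) * e k n i = z := by
  obtain ⟨z, hz⟩ := z
  obtain ⟨x, rfl⟩ := Submodule.mem_span_singleton.1 hz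
  change x * e k n i * e k n i = x * e k n i
  rw [mul_assoc, e_mul_e, if_pos rfl]

/-- The map `y ↦ e_j d y` of right modules from `e_i Λ` to `e_j Λ`. -/
noncomputable def leftMul (i j : Fin (n + 1)) (d : Alg k n) :
    RightProj k n i →ₗ[k] RightProj k n j where
  toFun y := ⟨e k n j * (d * y), Submodule.mem_span_singleton.2 ⟨.op (d * y), rfl⟩⟩
  map_add' y y' := Subtype.ext (by
    change e k n j * (d * (y + y')) = e k n j * (d * y) + e k n j * (d * y'); simp only [mul_add])
  map_smul' c y := Subtype.ext (by
    change e k n j * (d * (c • (y : Alg k n))) = c • (e k n j * (d * y))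
    simp only [mul_smul_comm])

/-- The map `e_i Λ ⊗ N → e_j Λ ⊗ N` induced by `leftMul`. -/
noncomputable def leftMulTensor (i j : Fin (n + 1)) (d : Alg k n)
    (N : Type u) [AddCommGroup N] [Module k N] [Module (Alg k n) N] :
    BalancedTensor k (Alg k n) (RightProj k n i) N →ₗ[k]
      BalancedTensor k (Alg k n) (RightProj k n j) N :=
  Submodule.mapQ _ _ ((leftMul i j d).rTensor N) (by
    refine Submodule.span_le.2 ?_
    rintro _ ⟨r, x, m, rfl⟩
    refine Submodule.subset_span ⟨leftMul i j d r, x, m, ?_⟩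
    rw [map_sub, LinearMap.rTensor_tmul, LinearMap.rTensor_tmul]
    congr 2
    refine Subtype.ext ?_
    change e k n j * (d * (r * x)) = e k n j * (d * r) * x
    simp only [mul_assoc])

/-- The natural transformation `F_li ⟶ F_lj` given by `leftMul`. -/
noncomputable def leftMulNat (i j l : Fin (n + 1)) (d : Alg k n) :
    projFunctor k n l i ⟶ projFunctor k n l j where
  app N := ModuleCat.ofHom (TensorProduct.AlgebraTensorModule.lTensor (Alg k n) (LeftProj k n l)
    (leftMulTensor i j d N))
  naturality N N' f := by
    ext : 1
    refine TensorProduct.AlgebraTensorModule.curry_injective ?_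
    ext x y z
    rfl

theorem leftMulNat_comp (i j m l : Fin (n + 1)) (d d' : Alg k n) :
    leftMulNat i j l d ≫ leftMulNat j m l d' = leftMulNat i m l (d' * e k n j * d) := by
  ext N : 2
  ext : 1
  refine TensorProduct.AlgebraTensorModule.curry_injective ?_
  ext x y z
  refine congrArg (fun t => x ⊗ₜ[k] (Submodule.Quotient.mk (t ⊗ₜ[k] z) :
    BalancedTensor k (Alg k n) (RightProj k n m) N)) (Subtype.ext ?_)
  change e k n m * (d' * (e k n j * (d * y))) = e k n m * (d' * e k n j * d * y)
  simp only [mul_assoc]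

theorem leftMulNat_zero (i j l : Fin (n + 1)) : leftMulNat (k := k) i j l 0 = 0 := by
  ext N : 2
  ext : 1
  refine TensorProduct.AlgebraTensorModule.curry_injective ?_
  ext x y z
  have : leftMul i j (0 : Alg k n) y = 0 := Subtype.ext (by
    change e k n j * (0 * y) = 0; simp)
  change x ⊗ₜ[k] (Submodule.Quotient.mk (leftMul i j 0 y ⊗ₜ[k] z) :
    BalancedTensor k (Alg k n) (RightProj k n j) N) = 0
  rw [this, TensorProduct.zero_tmul, Submodule.Quotient.mk_zero, TensorProduct.tmul_zero]

/-! ### Detecting left multiplications and decomposing compositions -/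

theorem contract_leftMulTensor_unitMap (m : Fin (n + 1)) (d : Alg k n) (φ : Alg k n →ₗ[k] k)
    (V : Type u) [AddCommGroup V] [Module k V] (v : V) :
    contract m m φ V (leftMulTensor m m d (ModuleCat.of (Alg k n) (LeftProj k n m ⊗[k] V))
      (unitMap m m 1 V v)) = φ (e k n m * d * e k n m) • v := by
  change φ (e k n m * (d * e k n m) * (1 * e k n m)) • v = _
  rw [one_mul, mul_assoc (e k n m), mul_assoc d, e_mul_e, if_pos rfl, mul_assoc]

/-- The factor e_mΛe_m of the composition records d: the unit inserts e_m, left multiplication turns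
it into e_m d e_m, and φ evaluates this to 1. -/
theorem unitNat_leftMulNat_contractNat (m j l : Fin (n + 1)) (d : Alg k n) (φ : Alg k n →ₗ[k] k)
    (h : φ (e k n m * d * e k n m) = 1) :
    unitNat m m j l 1 ≫ Functor.whiskerLeft (projFunctor k n m j) (leftMulNat m m l d) ≫
      contractNat m m j l φ = 𝟙 _ := by
  ext N : 2
  ext : 1
  refine LinearMap.ext fun z => ?_
  change TensorProduct.AlgebraTensorModule.lTensor (Alg k n) (LeftProj k n l) (contract m m φ _)
    (TensorProduct.AlgebraTensorModule.lTensor (Alg k n) (LeftProj k n l) (leftMulTensor m m d _)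
      (TensorProduct.AlgebraTensorModule.lTensor (Alg k n) (LeftProj k n l) (unitMap m m 1 _) z)) = z
  induction z using TensorProduct.induction_on with
  | zero => simp only [map_zero]
  | add z z' hz hz' => simp only [map_add, hz, hz']
  | tmul x t =>
    refine (congrArg (fun t => x ⊗ₜ[k] t) (contract_leftMulTensor_unitMap m d φ _ t)).trans ?_
    simp only [h, one_smul]

theorem unitMap_sum_smul (i m : Fin (n + 1)) {ι : Type*} [Fintype ι] (r : ι → k) (c : ι → Alg k n)
    (V : Type u) [AddCommGroup V] [Module k V] (v : V) :
    ∑ t, unitMap i m (c t) V (r t • v) = unitMap i m (∑ t, r t • c t) V v := by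
  let T : Alg k n →ₗ[k] BalancedTensor k (Alg k n) (RightProj k n i)
      (ModuleCat.of (Alg k n) (LeftProj k n m ⊗[k] V)) :=
    Submodule.mkQ _ ∘ₗ TensorProduct.mk k _ (ModuleCat.of (Alg k n) (LeftProj k n m ⊗[k] V))
      (rightGen k i) ∘ₗ (changeScalars m V).symm.toLinearMap ∘ₗ (TensorProduct.mk k _ V).flip v ∘ₗ
      { toFun := fun c => ⟨c * e k n m, Submodule.smul_mem _ c (Submodule.subset_span rfl)⟩
        map_add' := fun c d => Subtype.ext (add_mul c d _)
        map_smul' := fun r c => Subtype.ext (smul_mul_assoc r c _) }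
  change _ = T (∑ t, r t • c t)
  rw [map_sum]
  refine Finset.sum_congr rfl fun t _ => ?_
  rw [map_smul, map_smul]
  rfl

/-- The composite depends on y and z only through yz, which lies in e_iΛe_m. So a basis of all of Λ
may be replaced by coordinates on this subspace. -/
theorem sum_contract_unitMap_of_coord {i m : Fin (n + 1)} {ι : Type*} [Fintype ι] (c : ι → Alg k n)
    (φ : ι → (Alg k n →ₗ[k] k))
    (h : ∀ x, ∑ t, φ t (e k n i * x * e k n m) • c t = e k n i * x * e k n m)
    (V : Type u) [AddCommGroup V] [Module k V] :
    ∑ t, unitMap i m (c t) V ∘ₗ contract i m (φ t) V = LinearMap.id := by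
  rw [← sum_contract_unitMap (k := k) (n := n) i m V]
  refine Submodule.linearMap_qext _ (TensorProduct.ext' fun y w => ?_)
  simp only [LinearMap.comp_apply, LinearMap.sum_apply]
  induction w using TensorProduct.induction_on with
  | zero =>
    change ∑ t, unitMap i m _ V (contract i m _ V (Submodule.mkQ _ (y ⊗ₜ[k] 0))) =
      ∑ t, unitMap i m _ V (contract i m _ V (Submodule.mkQ _ (y ⊗ₜ[k] 0)))
    simp only [TensorProduct.tmul_zero, map_zero, Finset.sum_const_zero]
  | add w w' hw hw' =>
    have := congrArg₂ (· + ·) hw hw'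
    simp only [← Finset.sum_add_distrib, ← map_add, ← TensorProduct.tmul_add] at this
    exact this
  | tmul z v =>
    refine (unitMap_sum_smul i m (fun t => φ t ((y : Alg k n) * z)) c V v).trans
      (Eq.trans ?_ (unitMap_sum_smul i m
        (fun t => (Module.finBasis k (Alg k n)).coord t ((y : Alg k n) * z))
        (fun t => Module.finBasis k (Alg k n) t) V v).symm)
    have h1 : (y : Alg k n) * z = e k n i * (y * z) * e k n m := by
      rw [mul_assoc, mul_assoc, coe_mul_e, ← mul_assoc, e_mul_coe]
    have h2 : ∑ t, (Module.finBasis k (Alg k n)).coord t ((y : Alg k n) * z) •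
        Module.finBasis k (Alg k n) t = (y : Alg k n) * z :=
      (Module.finBasis k (Alg k n)).sum_repr _
    rw [h2]
    conv_lhs => rw [h1]
    rw [h, ← h1]

theorem sum_lTensor_comp (l : Fin (n + 1)) {ι : Type*} [Fintype ι] {V W : Type u} [AddCommGroup V]
    [Module k V] [AddCommGroup W] [Module k W] (f : ι → (V →ₗ[k] W)) (g : ι → (W →ₗ[k] V))
    (h : ∑ t, g t ∘ₗ f t = LinearMap.id) :
    ∑ t, TensorProduct.AlgebraTensorModule.lTensor (Alg k n) (LeftProj k n l) (g t) ∘ₗ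
      TensorProduct.AlgebraTensorModule.lTensor (Alg k n) (LeftProj k n l) (f t) =
        LinearMap.id := by
  refine TensorProduct.AlgebraTensorModule.curry_injective ?_
  ext x y
  have h := LinearMap.congr_fun h y
  simp only [LinearMap.sum_apply, LinearMap.comp_apply, LinearMap.id_apply] at h
  simp [← TensorProduct.tmul_sum, h]

theorem sum_contractNat_unitNat_of_coord {i m : Fin (n + 1)} {ι : Type*} [Fintype ι]
    (c : ι → Alg k n) (φ : ι → (Alg k n →ₗ[k] k))
    (h : ∀ x, ∑ t, φ t (e k n i * x * e k n m) • c t = e k n i * x * e k n m) (j l : Fin (n + 1)) :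
    ∑ t, contractNat i m j l (φ t) ≫ unitNat i m j l (c t) = 𝟙 _ := by
  ext N : 2
  rw [NatTrans.app_sum]
  ext : 1
  rw [ModuleCat.hom_sum]
  exact sum_lTensor_comp l _ _ (sum_contract_unitMap_of_coord c φ h
    (BalancedTensor k (Alg k n) (RightProj k n j) N))

/-! ### Projective functors preserve finitely generated projective modules -/

instance finite_rightProj (i : Fin (n + 1)) : Module.Finite k (RightProj k n i) :=
  inferInstanceAs (Module.Finite k ((Submodule.span (Alg k n)ᵐᵒᵖ {e k n i}).restrictScalars k))

instance finite_leftProj (i : Fin (n + 1)) : Module.Finite k (LeftProj k n i) :=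
  inferInstanceAs (Module.Finite k ((Submodule.span (Alg k n) {e k n i}).restrictScalars k))

instance projective_leftProj (i : Fin (n + 1)) : Module.Projective (Alg k n) (LeftProj k n i) :=
  Module.Projective.of_split (Submodule.span (Alg k n) {e k n i}).subtype
    (LinearMap.toSpanSingleton (Alg k n) (LeftProj k n i) ⟨e k n i, Submodule.subset_span rfl⟩)
    (LinearMap.ext fun z => Subtype.ext (coe_mul_e z))

/-- The value is Λe_i ⊗ V for a finite dimensional space V, that is, a finite sum of copies of the
projective module Λe_i. -/
theorem projFunctor_obj_property (i j : Fin (n + 1)) (N : ModuleCat.{u} (Alg k n))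
    [Module.Finite (Alg k n) N] :
    Module.Finite (Alg k n) ((projFunctor k n i j).obj N) ∧
      Module.Projective (Alg k n) ((projFunctor k n i j).obj N) := by
  have : Module.Finite k N := Module.Finite.trans (Alg k n) N
  refine ⟨?_, inferInstanceAs (Module.Projective (Alg k n)
    (LeftProj k n i ⊗[k] BalancedTensor k (Alg k n) (RightProj k n j) N))⟩
  have : Module.Finite k (LeftProj k n i ⊗[k] BalancedTensor k (Alg k n) (RightProj k n j) N) :=
    inferInstance
  exact Module.Finite.of_restrictScalars_finite k (Alg k n)
    (LeftProj k n i ⊗[k] BalancedTensor k (Alg k n) (RightProj k n j) N)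

end

end StarAlg

/-! ### Lifting natural transformations along a fully faithful functor -/

section Lift

variable {C : Type*} [Category* C] {D : Type*} [Category* D] {K : C ⥤ D} [K.Full] [K.Faithful]

/-- If the endofunctors `G` and `G'` of `C` correspond to the endofunctors `P` and `P'` of `D`, then
natural transformations from `P` to `P'` induce natural transformations from `G` to `G'`. -/
noncomputable def liftNat {G G' : C ⥤ C} {P P' : D ⥤ D} (e : G ⋙ K ≅ K ⋙ P) (e' : G' ⋙ K ≅ K ⋙ P')
    (θ : P ⟶ P') : G ⟶ G' where
  app X := K.preimage (e.hom.app X ≫ θ.app (K.obj X) ≫ e'.inv.app X)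
  naturality X Y f := K.map_injective (by
    have h1 := e.hom.naturality f
    have h2 := e'.inv.naturality f
    simp only [Functor.comp_map] at h1 h2
    simp only [Functor.map_comp, Functor.map_preimage, Category.assoc]
    rw [← h2, reassoc_of% h1, θ.naturality_assoc])

theorem map_liftNat_app {G G' : C ⥤ C} {P P' : D ⥤ D} (e : G ⋙ K ≅ K ⋙ P) (e' : G' ⋙ K ≅ K ⋙ P')
    (θ : P ⟶ P') (X : C) : K.map ((liftNat e e' θ).app X) =
      e.hom.app X ≫ θ.app (K.obj X) ≫ e'.inv.app X := K.map_preimage _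

theorem liftNat_comp {G G' G'' : C ⥤ C} {P P' P'' : D ⥤ D} (e : G ⋙ K ≅ K ⋙ P)
    (e' : G' ⋙ K ≅ K ⋙ P') (e'' : G'' ⋙ K ≅ K ⋙ P'') (θ : P ⟶ P') (θ' : P' ⟶ P'') :
    liftNat e e' θ ≫ liftNat e' e'' θ' = liftNat e e'' (θ ≫ θ') := by
  ext X
  apply K.map_injective
  simp [map_liftNat_app]

theorem liftNat_id {G : C ⥤ C} {P : D ⥤ D} (e : G ⋙ K ≅ K ⋙ P) : liftNat e e (𝟙 P) = 𝟙 G := by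
  ext X
  apply K.map_injective
  simp [map_liftNat_app]

/-- The correspondence of endofunctors of `C` and `D` is compatible with composition. -/
def liftCompIso {G H : C ⥤ C} {P Q : D ⥤ D} (e : G ⋙ K ≅ K ⋙ P) (f : H ⋙ K ≅ K ⋙ Q) :
    (G ⋙ H) ⋙ K ≅ K ⋙ P ⋙ Q :=
  Functor.associator _ _ _ ≪≫ Functor.isoWhiskerLeft G f ≪≫ (Functor.associator _ _ _).symm ≪≫
    Functor.isoWhiskerRight e Q ≪≫ Functor.associator _ _ _

theorem whiskerLeft_liftNat {G H H' : C ⥤ C} {P Q Q' : D ⥤ D} (e : G ⋙ K ≅ K ⋙ P)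
    (f : H ⋙ K ≅ K ⋙ Q) (f' : H' ⋙ K ≅ K ⋙ Q') (θ : Q ⟶ Q') :
    Functor.whiskerLeft G (liftNat f f' θ) =
      liftNat (liftCompIso e f) (liftCompIso e f') (Functor.whiskerLeft P θ) := by
  ext X
  apply K.map_injective
  -- Conjugating θ by the isomorphism e changes nothing, by naturality of θ.
  have h : Q.map (e.hom.app X) ≫ θ.app (P.obj (K.obj X)) ≫ Q'.map (e.inv.app X) =
      θ.app (K.obj (G.obj X)) := by
    refine (congrArg _ (θ.naturality (e.inv.app X)).symm).trans ?_
    rw [← Category.assoc, ← Q.map_comp, e.hom_inv_id_app, Q.map_id, Category.id_comp]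
    rfl
  have h1 : (liftCompIso e f).hom.app X = f.hom.app (G.obj X) ≫ Q.map (e.hom.app X) := by
    simp [liftCompIso]
  have h2 : (liftCompIso e f').inv.app X = Q'.map (e.inv.app X) ≫ f'.inv.app (G.obj X) := by
    simp [liftCompIso]
  rw [map_liftNat_app, Functor.whiskerLeft_app, map_liftNat_app, h1, h2, ← h]
  simp only [Category.assoc, Functor.whiskerLeft_app]

variable [Preadditive C] [Preadditive D] [K.Additive]

theorem liftNat_zero {G G' : C ⥤ C} {P P' : D ⥤ D} (e : G ⋙ K ≅ K ⋙ P) (e' : G' ⋙ K ≅ K ⋙ P') :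
    liftNat e e' 0 = 0 := by
  ext X
  apply K.map_injective
  simp [map_liftNat_app]

theorem liftNat_sum {G G' : C ⥤ C} {P P' : D ⥤ D} (e : G ⋙ K ≅ K ⋙ P) (e' : G' ⋙ K ≅ K ⋙ P')
    {ι : Type*} [Fintype ι] (θ : ι → (P ⟶ P')) :
    liftNat e e' (∑ t, θ t) = ∑ t, liftNat e e' (θ t) := by
  ext X
  apply K.map_injective
  simp [map_liftNat_app, NatTrans.app_sum, Functor.map_sum, Preadditive.sum_comp,
    Preadditive.comp_sum]

end Lift

/-! ### The relations of the right cell 2-category -/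

section RightCellRelations

variable {k : Type u} [Field k] {n : ℕ} {C : Type u₁} [Category.{v₁} C]

theorem exists_isProjFunctor (E : C ≌ FGProj (StarAlg.Alg k n)) (i j : Fin (n + 1)) :
    ∃ G : C ⥤ C, IsProjFunctor E i j G := by
  let L : C ⥤ FGProj (StarAlg.Alg k n) := ObjectProperty.lift _ (toMod E ⋙ StarAlg.projFunctor k n i j)
    fun X => by
      have : Module.Finite (StarAlg.Alg k n) ((toMod E).obj X) := (E.functor.obj X).property.1
      exact StarAlg.projFunctor_obj_property i j ((toMod E).obj X)
  exact ⟨L ⋙ E.inverse, ⟨Functor.associator _ _ _ ≪≫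
    Functor.isoWhiskerLeft L ((Functor.associator _ _ _).symm ≪≫
      Functor.isoWhiskerRight E.counitIso _ ≪≫ Functor.leftUnitor _)⟩⟩

/-- Two endofunctors corresponding to the same bimodule are isomorphic. -/
theorem IsProjFunctor.nonempty_iso {E : C ≌ FGProj (StarAlg.Alg k n)} {i j : Fin (n + 1)}
    {G H : C ⥤ C} (hG : IsProjFunctor E i j G) (hH : IsProjFunctor E i j H) : Nonempty (G ≅ H) := by
  obtain ⟨e⟩ := hG
  obtain ⟨f⟩ := hH
  exact ⟨⟨liftNat e f (𝟙 _), liftNat f e (𝟙 _), by rw [liftNat_comp, Category.comp_id, liftNat_id],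
    by rw [liftNat_comp, Category.comp_id, liftNat_id]⟩⟩

namespace RightCell

variable [Preadditive C] (E : C ≌ FGProj (StarAlg.Alg k n)) [E.functor.Additive]

/-- The 1-morphism `F_0j`. -/
noncomputable def proj (j : Fin (n + 1)) : (star : RightCell E) ⟶ star :=
  ⟨(exists_isProjFunctor E 0 j).choose,
    addClosure_of_mem (Or.inr ⟨j, (exists_isProjFunctor E 0 j).choose_spec⟩)⟩

/-- The functor underlying `F_0j` corresponds to the bimodule `Λ e_0 ⊗ e_j Λ`. -/
noncomputable def projIso (j : Fin (n + 1)) :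
    (proj E j).obj ⋙ toMod E ≅ toMod E ⋙ StarAlg.projFunctor k n 0 j :=
  (exists_isProjFunctor E 0 j).choose_spec.some

/-- The 2-morphism between 1-morphisms induced by a transformation of endofunctors of `Λ`-modules. -/
noncomputable def liftHom {F G : (star : RightCell E) ⟶ star}
    {P Q : ModuleCat.{u} (StarAlg.Alg k n) ⥤ ModuleCat.{u} (StarAlg.Alg k n)}
    (e : F.obj ⋙ toMod E ≅ toMod E ⋙ P) (e' : G.obj ⋙ toMod E ≅ toMod E ⋙ Q) (θ : P ⟶ Q) : F ⟶ G :=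
  ObjectProperty.homMk (liftNat e e' θ)

theorem sum_hom {F G : (star : RightCell E) ⟶ star} {ι : Type*} (s : Finset ι) (f : ι → (F ⟶ G)) :
    (∑ t ∈ s, f t).hom = ∑ t ∈ s, (f t).hom :=
  (ObjectProperty.ι (rightCellMor E)).map_sum f s

open Bicategory

/-- This is F_0i ∘ F_0j as a summand of copies of F_0j, one for each coordinate on e_iΛe_0. -/
theorem exists_sum_proj_comp (hn : 1 ≤ n) (i j : Fin (n + 1)) :
    ∃ (p : Fin (StarAlg.centreDim n i) → (proj E j ≫ proj E i ⟶ proj E j))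
      (q : Fin (StarAlg.centreDim n i) → (proj E j ⟶ proj E j ≫ proj E i)),
      ∑ t, p t ≫ q t = 𝟙 _ := by
  obtain ⟨c, φ, h⟩ := StarAlg.exists_coord k n hn i
  let e := liftCompIso (projIso E j) (projIso E i)
  refine ⟨fun t => liftHom E (F := proj E j ≫ proj E i) e (projIso E j)
    (StarAlg.contractNat i 0 j 0 (φ t)), fun t => liftHom E (G := proj E j ≫ proj E i)
    (projIso E j) e (StarAlg.unitNat i 0 j 0 (c t)), ?_⟩
  refine ObjectProperty.hom_ext _ ((sum_hom E _ _).trans ?_)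
  change ∑ t, liftNat e (projIso E j) _ ≫ liftNat (projIso E j) e _ = 𝟙 ((proj E j).obj ⋙ (proj E i).obj)
  simp only [liftNat_comp]
  rw [← liftNat_sum, StarAlg.sum_contractNat_unitNat_of_coord c φ h, liftNat_id]

/-- The endomorphism α is left multiplication by c = b_i a_i on e_0Λ. Its square vanishes since b_i
a_i b_i = 0, and it passes through e_jΛ for each leaf j since c = b_j a_j. -/
theorem exists_nilpotent (hn : 1 ≤ n) :
    ∃ α : proj E 0 ⟶ proj E 0, α ≫ α = 0 ∧
      (∀ j, j ≠ 0 → ∃ (β : proj E 0 ⟶ proj E j) (γ : proj E j ⟶ proj E 0), α = β ≫ γ) ∧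
      ∀ j, ∃ (p : proj E j ⟶ proj E j ≫ proj E 0) (q : proj E j ≫ proj E 0 ⟶ proj E j),
        p ≫ (proj E j ◁ α) ≫ q = 𝟙 _ := by
  have h0 := StarAlg.b_mul_a_ne_zero k n ⟨0, hn⟩
  set c := StarAlg.b k n ⟨0, hn⟩ * StarAlg.a k n ⟨0, hn⟩ with hc
  have hce : StarAlg.e k n 0 * c * StarAlg.e k n 0 = c := by
    rw [hc, ← mul_assoc, StarAlg.e_mul_b, if_pos rfl, mul_assoc, StarAlg.a_mul_e, if_pos rfl]
  -- As c is non-zero, some linear form does not vanish on it. Rescaled to take the value 1 at c, it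
  -- retracts α at F_0j onto the identity.
  obtain ⟨φ, hφ⟩ := Module.Projective.exists_dual_ne_zero k h0
  refine ⟨liftHom E (projIso E 0) (projIso E 0) (StarAlg.leftMulNat 0 0 0 c), ?_, ?_, ?_⟩
  · refine ObjectProperty.hom_ext _ ?_
    change liftNat _ _ _ ≫ liftNat _ _ _ = 0
    rw [liftNat_comp, StarAlg.leftMulNat_comp, ← liftNat_zero (projIso E 0) (projIso E 0),
      ← StarAlg.leftMulNat_zero]
    congr 2
    rw [hc, mul_assoc _ _ (StarAlg.e k n 0), StarAlg.a_mul_e, if_pos rfl, ← mul_assoc,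
      StarAlg.bab_eq_zero, zero_mul]
  · intro j hj
    obtain ⟨i, rfl⟩ := Fin.exists_succ_eq.2 hj
    refine ⟨liftHom E (projIso E 0) (projIso E i.succ) (StarAlg.leftMulNat 0 i.succ 0 (StarAlg.a k n i)),
      liftHom E (projIso E i.succ) (projIso E 0) (StarAlg.leftMulNat i.succ 0 0 (StarAlg.b k n i)), ?_⟩
    refine ObjectProperty.hom_ext _ ?_
    change liftNat _ _ _ = liftNat _ _ _ ≫ liftNat _ _ _
    rw [liftNat_comp, StarAlg.leftMulNat_comp, StarAlg.b_mul_e, if_pos rfl, hc,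
      StarAlg.b_mul_a_eq k n _ i]
  · intro j
    let e := liftCompIso (projIso E j) (projIso E 0)
    refine ⟨liftHom E (G := proj E j ≫ proj E 0) (projIso E j) e (StarAlg.unitNat 0 0 j 0 1),
      liftHom E (F := proj E j ≫ proj E 0) e (projIso E j)
        (StarAlg.contractNat 0 0 j 0 ((φ c)⁻¹ • φ)), ?_⟩
    refine ObjectProperty.hom_ext _ ?_
    change liftNat (projIso E j) e _ ≫ Functor.whiskerLeft (proj E j).obj (liftNat _ _ _) ≫
      liftNat e (projIso E j) _ = 𝟙 (proj E j).obj
    rw [whiskerLeft_liftNat (projIso E j), liftNat_comp, liftNat_comp,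
      StarAlg.unitNat_leftMulNat_contractNat, liftNat_id]
    rw [hce, LinearMap.smul_apply, smul_eq_mul, inv_mul_cancel₀ hφ]

/-- Every 1-morphism is a direct summand of a direct sum of copies of the identity and the `F_0j`. -/
theorem exists_sum_eq_id (F : (star : RightCell E) ⟶ star) :
    ∃ (ι : Type) (_ : Fintype ι) (Y : ι → ((star : RightCell E) ⟶ star)),
      (∀ t, Nonempty (Y t ≅ 𝟙 _) ∨ ∃ j, Nonempty (Y t ≅ proj E j)) ∧
      ∃ (s : ∀ t, F ⟶ Y t) (r : ∀ t, Y t ⟶ F), ∑ t, s t ≫ r t = 𝟙 F := by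
  obtain ⟨ι, _, Y, hY, s, r, h⟩ := F.property
  refine ⟨ι, inferInstance, fun t => ⟨Y t, addClosure_of_mem (hY t)⟩, fun t => ?_,
    fun t => ObjectProperty.homMk (s t), fun t => ObjectProperty.homMk (r t), ?_⟩
  · obtain ⟨⟨e⟩⟩ | ⟨j, hj⟩ := hY t
    · exact .inl ⟨ObjectProperty.isoMk _ e⟩
    · exact .inr ⟨j, ⟨ObjectProperty.isoMk _
        (hj.nonempty_iso (exists_isProjFunctor E 0 j).choose_spec).some⟩⟩
  · exact ObjectProperty.hom_ext _ ((sum_hom E _ _).trans h)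

end RightCell

end RightCellRelations

/-! ### Simple transitive 2-representations -/

namespace FinitaryRep

open Bicategory

variable {k : Type u} [Field k] {D : Type u₁} [Bicategory.{w', v'} D]
  [∀ i j : D, Preadditive (i ⟶ j)] [∀ i j : D, Linear k (i ⟶ j)]
  (M : FinitaryRep.{u, w, v, w', v', u₁} k D)

instance {i j : D} (F : i ⟶ j) : (M.act F).Additive := (M.map F).property.1

/-- The natural transformation by which a 2-morphism acts. -/
def actHom {i j : D} {F G : i ⟶ j} (α : F ⟶ G) : M.act F ⟶ M.act G := (M.map₂ α).hom

theorem actHom_comp {i j : D} {F G H : i ⟶ j} (α : F ⟶ G) (β : G ⟶ H) :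
    M.actHom (α ≫ β) = M.actHom α ≫ M.actHom β :=
  congrArg (fun f => f.hom) (M.map₂_comp α β)

theorem actHom_id {i j : D} (F : i ⟶ j) : M.actHom (𝟙 F) = 𝟙 (M.act F) :=
  congrArg (fun f => f.hom) (M.map₂_id F)

/-- The action on 2-morphisms is additive. -/
def actAddHom {i j : D} (F G : i ⟶ j) : (F ⟶ G) →+ (M.act F ⟶ M.act G) :=
  AddMonoidHom.mk' M.actHom M.map₂_add

/-- The action of isomorphic 1-morphisms. -/
def actIso {i j : D} {F G : i ⟶ j} (e : F ≅ G) : M.act F ≅ M.act G where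
  hom := M.actHom e.hom
  inv := M.actHom e.inv
  hom_inv_id := by rw [← actHom_comp, e.hom_inv_id, actHom_id]
  inv_hom_id := by rw [← actHom_comp, e.inv_hom_id, actHom_id]

/-- The action of the identity. -/
def actIdIso (i : D) : M.act (𝟙 i) ≅ 𝟭 (M.obj i) := (ObjectProperty.ι _).mapIso (M.mapId i)

/-- The action of a composition. -/
def actCompIso {i j l : D} (F : i ⟶ j) (G : j ⟶ l) : M.act (F ≫ G) ≅ M.act F ⋙ M.act G :=
  (ObjectProperty.ι _).mapIso (M.mapComp F G)

theorem actHom_whiskerLeft {i j l : D} (F : i ⟶ j) {G H : j ⟶ l} (α : G ⟶ H) :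
    M.actHom (F ◁ α) = (M.actCompIso F G).hom ≫ Functor.whiskerLeft (M.act F) (M.actHom α) ≫
      (M.actCompIso F H).inv :=
  congrArg (fun f => f.hom) (M.map₂_whisker_left F α)

theorem sum_actHom_app {i j : D} {F : i ⟶ j} {ι : Type*} [Fintype ι] {Y : ι → (i ⟶ j)}
    (s : ∀ t, F ⟶ Y t) (r : ∀ t, Y t ⟶ F) (h : ∑ t, s t ≫ r t = 𝟙 F) (X : M.obj i) :
    ∑ t, (M.actHom (s t)).app X ≫ (M.actHom (r t)).app X = 𝟙 _ := by
  have h1 := congrArg (fun α => (M.actAddHom F F α).app X) h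
  simp only [map_sum, NatTrans.app_sum] at h1
  refine Eq.trans (Finset.sum_congr rfl fun t _ => ?_) (h1.trans ?_)
  · exact (congrArg (fun α => α.app X) (M.actHom_comp (s t) (r t))).symm
  · exact congrArg (fun α => α.app X) (M.actHom_id F)

end FinitaryRep

/-- The relations among the F_0j are equations between 2-morphisms, so `M` carries them to the
functors `M.act (proj E j)`, where the counting argument applies. -/
theorem FinitaryRep.iso_of_indecomposable {k : Type u} [Field k] {n : ℕ} (hn : 1 ≤ n)
    {C : Type u₁} [Category.{v₁} C] [Preadditive C] [Linear k C]
    (E : C ≌ FGProj (StarAlg.Alg k n)) [E.functor.Additive]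
    (M : FinitaryRep.{u, w, v} k (RightCell E)) (htrans : M.IsTransitive)
    {X Y : M.obj RightCell.star} (hX : Indecomposable X) (hY : Indecomposable Y) :
    Nonempty (X ≅ Y) := by
  obtain ⟨ℓ⟩ := (M.obj RightCell.star).nonempty_lengthFunction
  obtain ⟨α, hα, hfac, hunit⟩ := RightCell.exists_nilpotent E hn
  refine ℓ.iso_of_indecomposable (fun j => M.act (RightCell.proj E j)) hn ?_ (StarAlg.centreDim n)
    (by simp [StarAlg.centreDim]) (fun j hj => by simp [StarAlg.centreDim, hj]) ?_ (M.actHom α) ?_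
    ?_ ?_ hX hY
  · intro X Y hX hY
    obtain ⟨F, ⟨ρ⟩⟩ := htrans _ _ X Y hX hY
    -- The 1-morphism given by transitivity is a summand of a sum of generators. By exchange, Y is
    -- already a retract of the value at X of one generator, which is the identity or some F_0j.
    obtain ⟨ι, _, Z, hZ, s, r, h⟩ := RightCell.exists_sum_eq_id E F
    have h1 := M.sum_actHom_app s r h X
    obtain ⟨t, ⟨τ⟩⟩ := ℓ.exists_retract_of_sum hY (Y := fun t => (M.act (Z t)).obj X)
      (fun t => ρ.i ≫ (M.actHom (s t)).app X) (fun t => (M.actHom (r t)).app X ≫ ρ.r) (by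
        have h2 := ρ.retract
        rw [← Category.id_comp ρ.r, ← h1, Preadditive.sum_comp, Preadditive.comp_sum] at h2
        simpa only [Category.assoc] using h2)
    obtain ⟨⟨e⟩⟩ | ⟨j, ⟨e⟩⟩ := hZ t
    · exact .inl ⟨τ.trans (.ofIso ((M.actIso e ≪≫ M.actIdIso _).app X))⟩
    · exact .inr ⟨j, ⟨τ.trans (.ofIso ((M.actIso e).app X))⟩⟩
  · intro i j X
    obtain ⟨p, q, h⟩ := RightCell.exists_sum_proj_comp E hn i j
    have h1 := M.sum_actHom_app p q h X
    let e := (M.actCompIso (RightCell.proj E j) (RightCell.proj E i)).app X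
    refine ⟨fun t => e.inv ≫ (M.actHom (p t)).app X, fun t => (M.actHom (q t)).app X ≫ e.hom, ?_⟩
    refine Eq.trans ?_ e.inv_hom_id
    have h2 : e.inv ≫ (∑ t, (M.actHom (p t)).app X ≫ (M.actHom (q t)).app X) ≫ e.hom =
        e.inv ≫ e.hom := by rw [h1, Category.id_comp]
    rw [Preadditive.sum_comp, Preadditive.comp_sum] at h2
    simpa only [Category.assoc] using h2
  · intro X
    have h1 := congrArg (fun β => β.app X) (M.actHom_comp α α)
    rw [hα] at h1
    exact h1.symm.trans (congrArg (fun β => β.app X)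
      (M.actAddHom (RightCell.proj E 0) (RightCell.proj E 0)).map_zero)
  · intro j hj
    obtain ⟨β, γ, h⟩ := hfac j hj
    exact ⟨M.actHom β, M.actHom γ, by rw [h, M.actHom_comp]⟩
  · intro j X
    obtain ⟨p, q, h⟩ := hunit j
    let e := (M.actCompIso (RightCell.proj E j) (RightCell.proj E 0)).app X
    refine ⟨(M.actHom p).app X ≫ e.hom, e.inv ≫ (M.actHom q).app X, ?_⟩
    have h1 := congrArg (fun β => (M.actHom β).app X) h
    simp only [M.actHom_comp, M.actHom_whiskerLeft, M.actHom_id, NatTrans.comp_app,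
      Functor.whiskerLeft_app, Category.assoc] at h1
    simp only [Category.assoc]
    exact h1

theorem mainTheorem5 {k : Type u} [Field k] [IsAlgClosed k] (n : ℕ) (hn : 1 ≤ n)
    {C : Type u₁} [Category.{v₁} C] [Preadditive C] [Linear k C]
    (E : C ≌ FGProj (StarAlg.Alg k n)) [E.functor.Additive] [E.functor.Linear k]
    (M : FinitaryRep.{u, w, v} k (RightCell E)) (hsimple : M.IsSimple)
    (htrans : M.IsTransitive) :
    M.rank RightCell.star = 1 := by
  -- Simplicity supplies a non-zero object, and hence an indecomposable one.
  obtain ⟨⟨⟨⟩, X, hX⟩, -⟩ := hsimple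
  obtain ⟨ℓ⟩ := (M.obj RightCell.star).nonempty_lengthFunction
  obtain ⟨Y, hY, -⟩ := ℓ.exists_indecomposable_retract hX
  rw [FinitaryRep.rank, Nat.card_eq_one_iff_unique]
  refine ⟨⟨fun a b => ?_⟩, ⟨Quotient.mk _ ⟨Y, hY⟩⟩⟩
  induction a using Quotient.inductionOn
  induction b using Quotient.inductionOn
  exact Quotient.sound (M.iso_of_indecomposable hn E htrans (Subtype.property _) (Subtype.property _))
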